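/- Fix an o-minimal expansion $\mathcal R$ of the real field $\mathbb R$; "definable" means definable in $\mathcal R$ with parameters. (A subset of a finite-dimensional real vector space is definable if it is so after identifying the space with $\mathbb R^n$ by a basis; a map to the complex points of an algebraic variety is definable if it is so in affine charts.) Let $V$ be a finite-dimensional $\mathbb C$-vector space, let $G$ be a connected commutative algebraic group over $\mathbb C$, and let $\pi\colon V\to G(\mathbb C)$ be a complex analytic group homomorphism whose kernel $\Lambda=\pi^{-1}(e)$ is a discrete subgroup of $V$. Assume that $\pi$ has a definable large domain $F$, that is, $F\subseteq V$ is a connected open subset such that $V=F+\Lambda$ and the restriction $\pi|_F$ is definable. Let $X\subseteq V$ be either a definable connected real analytic submanifold of $V$ or an irreducible complex algebraic subvariety of $V$, and let $Z\subseteq G(\mathbb C)$ be the Zariski closure of $\pi(X)$. If $X$ is not covered by finitely many $\Lambda$-translates $\lambda+F$ ($\lambda\in\Lambda$) of $F$, then the stabilizer $\{g\in G(\mathbb C) : g\cdot Z=Z\}$ is infinite. -/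

import Mathlib

noncomputable section

namespace OMinFlow

open CategoryTheory AlgebraicGeometry
open scoped MonObj Pointwise

/-! ### O-minimal expansions of the real field and definable sets -/

/-- The `L`-structure on `ℝ` is an o-minimal expansion of the real field: the graphs of addition
and multiplication are definable, and every subset of `ℝ` that is definable with parameters is a
finite union of intervals (the order-connected subsets of `ℝ` are exactly the intervals of all
kinds, bounded or not, including the points). -/
structure IsOMinimalExpansion (L : FirstOrder.Language) [L.Structure ℝ] : Prop where
  definable_add : (Set.univ : Set ℝ).Definable L {x : Fin 3 → ℝ | x 0 + x 1 = x 2}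
  definable_mul : (Set.univ : Set ℝ).Definable L {x : Fin 3 → ℝ | x 0 * x 1 = x 2}
  finite_union : ∀ S : Set ℝ, (Set.univ : Set ℝ).Definable₁ L S →
    ∃ T : Set (Set ℝ), T.Finite ∧ (∀ I ∈ T, I.OrdConnected) ∧ S = ⋃₀ T

/-- A subset of a finite-dimensional real vector space is definable (with parameters) if it becomes
definable after fixing a basis. -/
def DefinableIn (L : FirstOrder.Language) [L.Structure ℝ] {E : Type*} [AddCommGroup E]
    [Module ℝ E] (S : Set E) : Prop :=
  ∃ b : Module.Basis (Fin (Module.finrank ℝ E)) ℝ E,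
    (Set.univ : Set ℝ).Definable L (b.equivFun '' S)

/-! ### Submanifolds and algebraic subvarieties of a vector space -/

/-- `X` is an (embedded) real analytic submanifold of `E`: around each of its points there is a
real analytic chart of `E` that straightens `X` to a linear subspace. -/
def IsAnalyticSubmanifold {E : Type*} [NormedAddCommGroup E] [NormedSpace ℝ E]
    (X : Set E) : Prop :=
  ∀ x ∈ X, ∃ (φ : OpenPartialHomeomorph E E) (W : Submodule ℝ E), x ∈ φ.source ∧
    AnalyticOnNhd ℝ φ φ.source ∧ AnalyticOnNhd ℝ φ.symm φ.target ∧
    X ∩ φ.source = φ ⁻¹' (W : Set E) ∩ φ.source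

/-- `X` is a (Zariski closed) complex algebraic subset of `V`: in linear coordinates it is the set
of common zeros of a set of polynomials. -/
def IsAlgebraicSubset {V : Type*} [AddCommGroup V] [Module ℂ V] (X : Set V) : Prop :=
  ∃ (b : Module.Basis (Fin (Module.finrank ℂ V)) ℂ V)
    (P : Set (MvPolynomial (Fin (Module.finrank ℂ V)) ℂ)),
    X = {v | ∀ p ∈ P, MvPolynomial.eval (b.equivFun v) p = 0}

/-- `X` is an irreducible complex algebraic subvariety of `V`. -/
def IsIrreducibleSubvariety {V : Type*} [AddCommGroup V] [Module ℂ V] (X : Set V) : Prop :=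
  IsAlgebraicSubset X ∧ X.Nonempty ∧
    ∀ A B : Set V, IsAlgebraicSubset A → IsAlgebraicSubset B → X ⊆ A ∪ B → X ⊆ A ∨ X ⊆ B

/-! ### Complex points of a scheme over `ℂ` -/

/-- The set `G(ℂ)` of complex points. When `G` is a group object this is a group through the
instance `Hom.group`. -/
abbrev CPoints (G : Over (Spec (.of ℂ))) : Type :=
  Over.mk (𝟙 (Spec (.of ℂ))) ⟶ G

/-- The point of the underlying topological space of `G` given by a complex point. -/
def CPoints.pt {G : Over (Spec (.of ℂ))} (g : CPoints G) : G.left :=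
  g.left (IsLocalRing.closedPoint ℂ)

/-- The Zariski topology on `G(ℂ)`. -/
abbrev zariskiTopology (G : Over (Spec (.of ℂ))) : TopologicalSpace (CPoints G) :=
  TopologicalSpace.induced CPoints.pt inferInstance

/-- The Zariski closure of a set of complex points, again as a set of complex points. -/
def zariskiClosure {G : Over (Spec (.of ℂ))} (S : Set (CPoints G)) : Set (CPoints G) :=
  @closure _ (zariskiTopology G) S

open Classical in
/-- The value `f(g) ∈ ℂ` of a regular function `f` on an open `U ⊆ G` at a complex point `g` of `U`
(and `0` if `g` is not in `U`). -/
def evalAt {G : Over (Spec (.of ℂ))} (U : G.left.Opens) (f : Γ(G.left, U)) (g : CPoints G) : ℂ :=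
  if h : (⊤ : (Spec (.of ℂ)).Opens) ≤ g.left ⁻¹ᵁ U then
    (Scheme.ΓSpecIso (.of ℂ)).hom (g.left.appLE U ⊤ h f)
  else 0

/-- `π : V → G(ℂ)` is complex analytic: it is a holomorphic map to the analytification of `G`, that
is, the preimage of every Zariski open `U` is open and every regular function on `U` pulls back to
a holomorphic function. On an affine `U ⊆ ℂⁿ` this says that `π⁻¹(U) → ℂⁿ` is holomorphic. -/
def IsComplexAnalytic {V : Type*} [NormedAddCommGroup V] [NormedSpace ℂ V]
    {G : Over (Spec (.of ℂ))} (π : V → CPoints G) : Prop :=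
  ∀ U : G.left.Opens, IsOpen {v | (π v).pt ∈ U} ∧
    ∀ f : Γ(G.left, U), AnalyticOnNhd ℂ (fun v => evalAt U f (π v)) {v | (π v).pt ∈ U}

/-- The restriction of `π : V → G(ℂ)` to `F` is definable, where `G(ℂ)` is viewed as a definable
set through its affine charts: `F` is definable, and for every affine open `U ⊆ G` the set
`F ∩ π⁻¹(U)` and the coordinate functions of `π` on it (as subsets of `V` and `V × ℂ`) are
definable. -/
def IsDefinableRestrict (L : FirstOrder.Language) [L.Structure ℝ] {V : Type*}
    [NormedAddCommGroup V] [NormedSpace ℂ V] {G : Over (Spec (.of ℂ))} (π : V → CPoints G)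
    (F : Set V) : Prop :=
  DefinableIn L F ∧ ∀ U : G.left.Opens, IsAffineOpen U →
    DefinableIn L {v | v ∈ F ∧ (π v).pt ∈ U} ∧
    ∀ f : Γ(G.left, U),
      DefinableIn L {q : V × ℂ | q.1 ∈ F ∧ (π q.1).pt ∈ U ∧ q.2 = evalAt U f (π q.1)}

/-- `F` is a definable large domain for the map `π : V → G(ℂ)` with kernel `Λ`. -/
structure IsDefinableLargeDomain (L : FirstOrder.Language) [L.Structure ℝ] {V : Type*}
    [NormedAddCommGroup V] [NormedSpace ℂ V] {G : Over (Spec (.of ℂ))} (π : V → CPoints G)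
    (Λ : AddSubgroup V) (F : Set V) : Prop where
  isOpen : IsOpen F
  isConnected : IsConnected F
  add_eq : F + (Λ : Set V) = Set.univ
  definable : IsDefinableRestrict L π F

end OMinFlow

end

noncomputable section

namespace OMinFlow

open Set FirstOrder

/-! ### Definable functions in an o-minimal expansion of the real field -/

section Definable

variable {L : FirstOrder.Language} [L.Structure ℝ] {α β : Type*}

/-! Let S be the set of v in V such that v + X meets F and (v + X) ∩ F lies in π⁻¹(Z). It is
definable, because only the restriction of π to F enters. Since π⁻¹(Z) is locally cut out by
holomorphic functions and F is open, the identity principle on X upgrades the inclusion to v + X ⊆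
π⁻¹(Z). Then π(v) translates Z into itself, hence onto itself because the Zariski topology is
Noetherian. So π(S) lies in the stabilizer.

If the stabilizer were finite, S would lie in finitely many cosets of the countable group Λ, and a
countable definable set is finite (`IsOMinimalExpansion.finite_of_countable`). But if λ + F meets X
with λ in Λ, then -λ lies in S. Hence only finitely many translates of F meet X; as all translates
together cover V, these cover X.

The identity principle for a submanifold is a connectedness argument in charts. For an irreducible
variety, `GenericCover` presents X by Noether normalization and a primitive element as the roots of
an irreducible monic polynomial P over ℂᵈ, away from δ = 0. The roots near which X lies in the
analytic set are stable under analytic continuation. The monic polynomial with such a set of roots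
has coefficients holomorphic and of polynomial growth off δ = 0, so it is a polynomial factor of P
(`IsMonodromyInvariant.all_or_none`). By irreducibility all roots or none are selected, and density
of the part over δ ≠ 0 finishes. -/

theorem definableFun_const (c : ℝ) : (univ : Set ℝ).DefinableFun L (fun _ : α → ℝ => c) :=
  L.definableFun_const α (mem_univ c)

theorem IsOMinimalExpansion.definableFun_add (hL : IsOMinimalExpansion L) {f g : (α → ℝ) → ℝ}
    (hf : (univ : Set ℝ).DefinableFun L f) (hg : (univ : Set ℝ).DefinableFun L g) :
    (univ : Set ℝ).DefinableFun L (fun v => f v + g v) := by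
  have h : (univ : Set ℝ).DefinableFun L (fun v : Fin 2 → ℝ => v 0 + v 1) :=
    hL.definable_add.preimage_comp ![some 0, some 1, none]
  have hF : (univ : Set ℝ).DefinableMap L (fun v => ![f v, g v]) := by
    intro i
    fin_cases i <;> assumption
  simpa using h.comp hF

theorem IsOMinimalExpansion.definableFun_mul (hL : IsOMinimalExpansion L) {f g : (α → ℝ) → ℝ}
    (hf : (univ : Set ℝ).DefinableFun L f) (hg : (univ : Set ℝ).DefinableFun L g) :
    (univ : Set ℝ).DefinableFun L (fun v => f v * g v) := by
  have h : (univ : Set ℝ).DefinableFun L (fun v : Fin 2 → ℝ => v 0 * v 1) :=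
    hL.definable_mul.preimage_comp ![some 0, some 1, none]
  have hF : (univ : Set ℝ).DefinableMap L (fun v => ![f v, g v]) := by
    intro i
    fin_cases i <;> assumption
  simpa using h.comp hF

theorem IsOMinimalExpansion.definableFun_sum (hL : IsOMinimalExpansion L) {ι : Type*}
    (s : Finset ι) {f : ι → (α → ℝ) → ℝ}
    (hf : ∀ i, (univ : Set ℝ).DefinableFun L (f i)) :
    (univ : Set ℝ).DefinableFun L (fun v => ∑ i ∈ s, f i v) := by
  classical
  induction s using Finset.induction_on with
  | empty => simpa using definableFun_const 0
  | insert a s ha ih => simpa [ha] using hL.definableFun_add (hf a) ih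

theorem IsOMinimalExpansion.definableFun_linear (hL : IsOMinimalExpansion L) [Finite α]
    (f : (α → ℝ) →ₗ[ℝ] ℝ) : (univ : Set ℝ).DefinableFun L f := by
  classical
  cases nonempty_fintype α
  have h : ⇑f = fun v : α → ℝ => ∑ i, v i * f (Pi.single i 1) := by
    ext v
    conv_lhs => rw [pi_eq_sum_univ' v, map_sum]
    simp
  rw [h]
  exact hL.definableFun_sum _ fun i =>
    hL.definableFun_mul (Set.DefinableFun.proj L) (definableFun_const _)

theorem IsOMinimalExpansion.definable_preimage_linear (hL : IsOMinimalExpansion L) [Finite α]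
    [Finite β] (f : (α → ℝ) →ₗ[ℝ] (β → ℝ)) {S : Set (β → ℝ)}
    (hS : (univ : Set ℝ).Definable L S) : (univ : Set ℝ).Definable L (f ⁻¹' S) :=
  hS.preimage_map fun i => hL.definableFun_linear (LinearMap.proj i ∘ₗ f)

/-- A countable definable subset of `ℝⁿ` is finite. -/
theorem IsOMinimalExpansion.finite_of_countable (hL : IsOMinimalExpansion L) [Finite α]
    {S : Set (α → ℝ)} (hS : (univ : Set ℝ).Definable L S) (hc : S.Countable) : S.Finite := by
  have hproj : ∀ i : α, ((fun v : α → ℝ => v i) '' S).Finite := by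
    intro i
    have hdef : (univ : Set ℝ).Definable₁ L ((fun v : α → ℝ => v i) '' S) := by
      have := hS.image_comp (fun _ : Fin 1 => i)
      unfold Set.Definable₁
      convert this using 1
      ext x
      constructor
      · rintro ⟨v, hv, h⟩
        refine ⟨v, hv, ?_⟩
        ext j
        fin_cases j
        exact h
      · rintro ⟨v, hv, rfl⟩
        exact ⟨v, hv, rfl⟩
    obtain ⟨T, hT, hI, hST⟩ := hL.finite_union _ hdef
    rw [hST]
    refine hT.sUnion fun I hIT => ?_
    have hIc : I.Countable := (hc.image _).mono (hST ▸ subset_sUnion_of_mem hIT)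
    -- An interval with two distinct points contains an uncountable segment, so each interval here
    -- has at most one point.
    refine Set.Subsingleton.finite fun a ha b hb => ?_
    by_contra hab
    have key : ∀ c ∈ I, ∀ d ∈ I, ¬ c < d := fun c hc d hd hlt =>
      (Cardinal.Real.Icc_countable_iff.not.mpr (not_le.mpr hlt))
        (hIc.mono ((hI I hIT).out hc hd))
    exact (lt_or_gt_of_ne hab).elim (key a ha b hb) (key b hb a ha)
  refine (Set.Finite.pi' hproj).subset fun v hv i => ⟨v, hv, rfl⟩

end Definable

/-! ### Definable subsets of finite-dimensional real vector spaces -/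

section DefinableIn

variable {L : FirstOrder.Language} [L.Structure ℝ] {E : Type*} [AddCommGroup E] [Module ℝ E]

/-- A change of basis is linear, hence definable, so definability does not depend on the basis. -/
theorem IsOMinimalExpansion.definable_image_equivFun (hL : IsOMinimalExpansion L) {S : Set E}
    (hS : DefinableIn L S) {α : Type*} [Finite α] (b : Module.Basis α ℝ E) :
    (univ : Set ℝ).Definable L (b.equivFun '' S) := by
  obtain ⟨c, hc⟩ := hS
  have := hL.definable_preimage_linear
    ((b.equivFun.symm.trans c.equivFun : (α → ℝ) ≃ₗ[ℝ] _) : (α → ℝ) →ₗ[ℝ] _) hc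
  convert this using 1
  ext v
  rw [LinearEquiv.image_eq_preimage_symm]
  simp

theorem IsOMinimalExpansion.definableIn_iff (hL : IsOMinimalExpansion L) {S : Set E}
    {α : Type*} [Finite α] (b : Module.Basis α ℝ E) :
    DefinableIn L S ↔ (univ : Set ℝ).Definable L (b.equivFun '' S) := by
  refine ⟨fun h => hL.definable_image_equivFun h b, fun h => ?_⟩
  cases nonempty_fintype α
  let e : α ≃ Fin (Module.finrank ℝ E) :=
    Fintype.equivFinOfCardEq (Module.finrank_eq_card_basis b).symm
  refine ⟨b.reindex e, ?_⟩
  convert h.image_comp e.symm using 1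
  rw [← image_comp]
  congr 1

variable [FiniteDimensional ℝ E]

theorem IsOMinimalExpansion.definableIn_diff (hL : IsOMinimalExpansion L) {S T : Set E}
    (hS : DefinableIn L S) (hT : DefinableIn L T) : DefinableIn L (S \ T) := by
  let b := Module.finBasis ℝ E
  rw [hL.definableIn_iff b] at *
  rw [image_sdiff b.equivFun.injective]
  exact hS.sdiff hT

theorem IsOMinimalExpansion.definableIn_biUnion (hL : IsOMinimalExpansion L) {ι : Type*}
    {s : Set ι} (hs : s.Finite) {S : ι → Set E} (hS : ∀ i ∈ s, DefinableIn L (S i)) :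
    DefinableIn L (⋃ i ∈ s, S i) := by
  let b := Module.finBasis ℝ E
  simp only [hL.definableIn_iff b] at *
  have := hs.to_subtype
  rw [biUnion_eq_iUnion, image_iUnion]
  exact definable_iUnion_of_finite fun i => hS i i.2

-- A vector v lies in S - T exactly when some u in T has v + u in S, so the difference is a
-- projection of a definable subset of E × E.
open scoped Pointwise in
theorem IsOMinimalExpansion.definableIn_sub (hL : IsOMinimalExpansion L) {S T : Set E}
    (hS : DefinableIn L S) (hT : DefinableIn L T) : DefinableIn L (S - T) := by
  let b := Module.finBasis ℝ E
  rw [hL.definableIn_iff b] at *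
  have h1 := hL.definable_preimage_linear (α := Fin (Module.finrank ℝ E) ⊕ Fin (Module.finrank ℝ E))
    (LinearMap.funLeft ℝ ℝ Sum.inl + LinearMap.funLeft ℝ ℝ Sum.inr) hS
  have h2 := hT.preimage_comp
    (Sum.inr : Fin (Module.finrank ℝ E) → Fin (Module.finrank ℝ E) ⊕ Fin (Module.finrank ℝ E))
  convert (h1.inter h2).exists_of_finite using 1
  ext v
  constructor
  · rintro ⟨_, ⟨x, hx, y, hy, rfl⟩, rfl⟩
    refine ⟨b.equivFun y, ⟨x, hx, ?_⟩, ⟨y, hy, ?_⟩⟩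
    · ext i
      simp [LinearMap.funLeft]
    · ext i
      simp
  · rintro ⟨u, ⟨x, hx, hxu⟩, ⟨y, hy, hyu⟩⟩
    refine ⟨_, ⟨x, hx, y, hy, rfl⟩, ?_⟩
    have e1 : b.equivFun y = u := by
      simpa [Function.comp_def] using hyu
    have e2 : b.equivFun x = v + u := by
      simpa [LinearMap.funLeft, Function.comp_def] using hxu
    rw [map_sub, e1, e2, add_sub_cancel_right]

theorem IsOMinimalExpansion.finite_of_definableIn_of_countable (hL : IsOMinimalExpansion L)
    {S : Set E} (hS : DefinableIn L S) (hc : S.Countable) : S.Finite := by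
  let b := Module.finBasis ℝ E
  rw [hL.definableIn_iff b] at hS
  exact Set.Finite.of_finite_image (hL.finite_of_countable hS (hc.image _))
    b.equivFun.injective.injOn

end DefinableIn

/-! ### Definability of complex algebraic subsets -/

section Algebraic

variable {L : FirstOrder.Language} [L.Structure ℝ] {α : Type*}

/-- A complex-valued function on `ℝⁿ` with definable real and imaginary parts. -/
def DefinableComplexFun (L : FirstOrder.Language) [L.Structure ℝ] (f : (α → ℝ) → ℂ) : Prop :=
  (univ : Set ℝ).DefinableFun L (fun v => (f v).re) ∧
    (univ : Set ℝ).DefinableFun L (fun v => (f v).im)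

theorem IsOMinimalExpansion.definableComplexFun_eval (hL : IsOMinimalExpansion L) {ι : Type*}
    {g : ι → (α → ℝ) → ℂ} (hg : ∀ i, DefinableComplexFun L (g i)) (p : MvPolynomial ι ℂ) :
    DefinableComplexFun L (fun v => MvPolynomial.eval (fun i => g i v) p) := by
  induction p using MvPolynomial.induction_on with
  | C a => simpa using ⟨definableFun_const _, definableFun_const _⟩
  | add p q hp hq =>
    simpa [DefinableComplexFun] using
      And.intro (hL.definableFun_add hp.1 hq.1) (hL.definableFun_add hp.2 hq.2)
  | mul_X p i hp =>
    have hneg : (univ : Set ℝ).DefinableFun L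
        (fun v => -1 * ((MvPolynomial.eval (fun i => g i v) p).im * (g i v).im)) :=
      hL.definableFun_mul (definableFun_const _) (hL.definableFun_mul hp.2 (hg i).2)
    constructor
    · convert hL.definableFun_add (hL.definableFun_mul hp.1 (hg i).1) hneg using 2
      simp
      ring
    · convert hL.definableFun_add (hL.definableFun_mul hp.1 (hg i).2)
        (hL.definableFun_mul hp.2 (hg i).1) using 2
      simp

variable {V : Type*} [NormedAddCommGroup V] [NormedSpace ℂ V] [FiniteDimensional ℂ V]

/-- By Hilbert's basis theorem finitely many equations suffice, and each has definable real and
imaginary parts. -/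
theorem IsAlgebraicSubset.definableIn (hL : IsOMinimalExpansion L) {X : Set V}
    (hX : IsAlgebraicSubset X) : DefinableIn L X := by
  obtain ⟨b, P, rfl⟩ := hX
  have : FiniteDimensional ℝ V := FiniteDimensional.complexToReal V
  let c := Module.finBasis ℝ V
  obtain ⟨s, hs⟩ := (inferInstance : IsNoetherian (MvPolynomial (Fin (Module.finrank ℂ V)) ℂ)
    (MvPolynomial (Fin (Module.finrank ℂ V)) ℂ)).noetherian (Ideal.span P)
  let g : Fin (Module.finrank ℂ V) → (Fin (Module.finrank ℝ V) → ℝ) → ℂ :=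
    fun i v => b.equivFun (c.equivFun.symm v) i
  have hg : ∀ i, DefinableComplexFun L (g i) := fun i => by
    let ℓ : (Fin (Module.finrank ℝ V) → ℝ) →ₗ[ℝ] ℂ :=
      ((b.coord i).restrictScalars ℝ) ∘ₗ (c.equivFun.symm : _ →ₗ[ℝ] V)
    exact ⟨hL.definableFun_linear (Complex.reLm ∘ₗ ℓ), hL.definableFun_linear (Complex.imLm ∘ₗ ℓ)⟩
  have hzero : ∀ p : MvPolynomial (Fin (Module.finrank ℂ V)) ℂ,
      (univ : Set ℝ).Definable L {v | MvPolynomial.eval (fun i => g i v) p = 0} := fun p => by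
    have h := hL.definableComplexFun_eval hg p
    convert (h.1.ofPred_eq_const (mem_univ 0)).inter (h.2.ofPred_eq_const (mem_univ 0)) using 1
    ext v
    simp [Complex.ext_iff]
  rw [hL.definableIn_iff c]
  convert definable_biInter_finset hzero s using 1
  rw [LinearEquiv.image_eq_preimage_symm]
  ext v
  have key : ∀ w : Fin (Module.finrank ℂ V) → ℂ,
      (∀ p ∈ P, MvPolynomial.eval w p = 0) ↔ ∀ p ∈ s, MvPolynomial.eval w p = 0 := by
    intro w
    have h1 : ∀ Q : Set (MvPolynomial (Fin (Module.finrank ℂ V)) ℂ),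
        (∀ p ∈ Q, MvPolynomial.eval w p = 0) ↔
          Ideal.span Q ≤ RingHom.ker (MvPolynomial.eval w) := by
      intro Q
      rw [Ideal.span_le]
      rfl
    rw [h1, ← hs]
    exact (h1 s).symm
  rw [mem_iInter₂]
  exact key (b.equivFun (c.equivFun.symm v))

end Algebraic

end OMinFlow

end

noncomputable section

namespace OMinFlow

open CategoryTheory AlgebraicGeometry
open scoped MonObj Pointwise

/-! ### Complex points of group schemes -/

section Points

variable {G : Over (Spec (.of ℂ))}

theorem CPoints.pt_comp {H : Over (Spec (.of ℂ))} (g : CPoints G) (f : G ⟶ H) :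
    CPoints.pt (g ≫ f) = f.left g.pt := by
  simp only [CPoints.pt, Over.comp_left]
  rfl

/-- The translation by a complex point of a group scheme. -/
def translation [GrpObj G] (g : CPoints G) : G ⟶ G :=
  Over.homMk G.hom ≫ g * 𝟙 G

theorem comp_translation [GrpObj G] (g h : CPoints G) : h ≫ translation g = g * h := by
  rw [translation, MonObj.comp_mul, ← Category.assoc]
  congr 1
  · have : h ≫ Over.homMk G.hom = 𝟙 (Over.mk (𝟙 (Spec (.of ℂ)))) := by
      ext1
      simp
    rw [this, Category.id_comp]

theorem isNoetherian_left [LocallyOfFiniteType G.hom] [QuasiCompact G.hom] :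
    IsNoetherian G.left := by
  have : IsLocallyNoetherian G.left := LocallyOfFiniteType.isLocallyNoetherian G.hom
  have : CompactSpace G.left := QuasiCompact.compactSpace_of_compactSpace G.hom
  constructor

theorem noetherianSpace_zariskiTopology [LocallyOfFiniteType G.hom] [QuasiCompact G.hom] :
    @TopologicalSpace.NoetherianSpace (CPoints G) (zariskiTopology G) := by
  let := zariskiTopology G
  have := isNoetherian_left (G := G)
  exact Topology.IsInducing.noetherianSpace (i := CPoints.pt) ⟨rfl⟩

theorem continuous_mul_left_zariski [GrpObj G] (g : CPoints G) :
    @Continuous _ _ (zariskiTopology G) (zariskiTopology G) (fun h => g * h) := by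
  let := zariskiTopology G
  have hi : Topology.IsInducing (CPoints.pt (G := G)) := ⟨rfl⟩
  rw [hi.continuous_iff]
  have : CPoints.pt ∘ (fun h : CPoints G => g * h) = (translation g).left ∘ CPoints.pt := by
    ext h
    simp [← comp_translation, CPoints.pt_comp]
  rw [this]
  exact (translation g).left.continuous.comp hi.continuous

/-- A Zariski closed set that is mapped into itself by a translation is invariant under it. -/
theorem smul_eq_of_smul_subset [GrpObj G] [LocallyOfFiniteType G.hom] [QuasiCompact G.hom]
    {Z : Set (CPoints G)} (hZ : @IsClosed _ (zariskiTopology G) Z) {g : CPoints G}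
    (hg : g • Z ⊆ Z) : g • Z = Z := by
  let := zariskiTopology G
  have := noetherianSpace_zariskiTopology (G := G)
  have hcl : ∀ n : ℕ, IsClosed (g ^ n • Z) := by
    intro n
    rw [← Set.preimage_smul_inv]
    exact hZ.preimage (continuous_mul_left_zariski ((g ^ n)⁻¹))
  -- The closed sets gⁿZ decrease, so gⁿZ = gⁿ⁺¹Z for some n by Noetherianity; then gⁿ is cancelled.
  let c : ℕ →o (TopologicalSpace.Closeds (CPoints G))ᵒᵈ :=
    { toFun := fun n => OrderDual.toDual ⟨g ^ n • Z, hcl n⟩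
      monotone' := monotone_nat_of_le_succ fun n => by
        change g ^ (n + 1) • Z ⊆ g ^ n • Z
        rw [pow_succ, mul_smul]
        exact Set.smul_set_mono hg }
  obtain ⟨n, hn⟩ := WellFoundedGT.monotone_chain_condition c
  have h := hn (n + 1) n.le_succ
  have h' : g ^ n • Z = g ^ (n + 1) • Z :=
    congrArg (fun s => ((OrderDual.ofDual s : TopologicalSpace.Closeds (CPoints G)) :
      Set (CPoints G))) h
  rw [pow_succ, mul_smul] at h'
  exact (smul_left_cancel _ h').symm

/-- The stabilizer of a Zariski closure contains every point that translates the set into it. -/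
theorem mem_stabilizer_zariskiClosure [GrpObj G] [LocallyOfFiniteType G.hom]
    [QuasiCompact G.hom] {S : Set (CPoints G)} {g : CPoints G}
    (hg : ∀ h ∈ S, g * h ∈ zariskiClosure S) :
    g ∈ MulAction.stabilizer (CPoints G) (zariskiClosure S) := by
  let := zariskiTopology G
  have hcl : IsClosed (zariskiClosure S) := isClosed_closure
  refine smul_eq_of_smul_subset hcl ?_
  rintro _ ⟨h, hh, rfl⟩
  have : closure S ⊆ (fun h => g * h) ⁻¹' zariskiClosure S :=
    closure_minimal hg (hcl.preimage (continuous_mul_left_zariski g))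
  exact this hh

/-- The spectrum of ℂ has a single point, with maximal ideal zero. This translates Zariski
conditions into equations between complex numbers. -/
theorem CPoints.pt_mem_basicOpen_iff {U : G.left.Opens} (f : Γ(G.left, U)) {g : CPoints G}
    (hg : g.pt ∈ U) : g.pt ∈ G.left.basicOpen f ↔ evalAt U f g ≠ 0 := by
  have hU : (⊤ : (Spec (.of ℂ)).Opens) ≤ g.left ⁻¹ᵁ U := by
    intro x _
    have hx : x = IsLocalRing.closedPoint ℂ := Subsingleton.elim (α := PrimeSpectrum ℂ) _ _
    subst hx
    exact hg
  rw [evalAt, dif_pos hU]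
  have h1 : (Spec (.of ℂ)).basicOpen (g.left.appLE U ⊤ hU f) = g.left ⁻¹ᵁ G.left.basicOpen f := by
    simp [Scheme.Hom.appLE, Scheme.preimage_basicOpen]
  have h2 : g.pt ∈ G.left.basicOpen f ↔
      IsLocalRing.closedPoint ℂ ∈ (Spec (.of ℂ)).basicOpen (g.left.appLE U ⊤ hU f) := by
    rw [h1]
    rfl
  rw [h2, basicOpen_eq_of_affine']
  change _ ∉ IsLocalRing.maximalIdeal ℂ ↔ _
  simp

end Points

/-! ### Analytic sets and preimages of Zariski closed sets -/

section Analytic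

variable {V : Type*} [NormedAddCommGroup V] [NormedSpace ℂ V]

/-- A subset of a complex vector space that is locally the zero set of holomorphic functions. -/
def IsAnalyticSet (A : Set V) : Prop :=
  ∀ x, ∃ N, IsOpen N ∧ x ∈ N ∧ ∃ H : Set (V → ℂ),
    (∀ h ∈ H, AnalyticOnNhd ℂ h N) ∧ ∀ y ∈ N, y ∈ A ↔ ∀ h ∈ H, h y = 0

theorem IsAnalyticSet.preimage_add_left {A : Set V} (hA : IsAnalyticSet A) (v : V) :
    IsAnalyticSet ((fun x => v + x) ⁻¹' A) := by
  intro x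
  obtain ⟨N, hN, hx, H, hH, hHN⟩ := hA (v + x)
  refine ⟨(fun x => v + x) ⁻¹' N, hN.preimage (continuous_const_add v), hx,
    (fun h => h ∘ (fun x => v + x)) '' H, ?_, ?_⟩
  · rintro _ ⟨h, hh, rfl⟩
    exact (hH h hh).comp (analyticOnNhd_const.add analyticOnNhd_id) fun y hy => hy
  · intro y hy
    simpa using hHN (v + y) hy

variable {G : Over (Spec (.of ℂ))} {π : V → CPoints G}

/-- In an affine chart a closed set C is the common zero locus of the functions f whose basic open
set misses C; these pull back to holomorphic functions. -/
theorem IsComplexAnalytic.isAnalyticSet_preimage (hπ : IsComplexAnalytic π)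
    {Z : Set (CPoints G)} (hZ : @IsClosed _ (zariskiTopology G) Z) :
    IsAnalyticSet (π ⁻¹' Z) := by
  let := zariskiTopology G
  have hi : Topology.IsInducing (CPoints.pt (G := G)) := ⟨rfl⟩
  obtain ⟨C, hC, rfl⟩ := hi.isClosed_iff.mp hZ
  intro x
  obtain ⟨U, hU, hxU, -⟩ := exists_isAffineOpen_mem_and_subset (X := G.left) (x := (π x).pt)
    (U := ⊤) trivial
  refine ⟨_, (hπ U).1, hxU, (fun f v => evalAt U f (π v)) ''
    {f : Γ(G.left, U) | Disjoint (G.left.basicOpen f : Set G.left) C}, ?_, ?_⟩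
  · rintro _ ⟨f, -, rfl⟩
    exact (hπ U).2 f
  · intro y hy
    constructor
    · rintro hyC _ ⟨f, hf, rfl⟩
      by_contra hne
      exact Set.disjoint_left.mp hf ((CPoints.pt_mem_basicOpen_iff f hy).mpr hne) hyC
    · intro h
      by_contra hyC
      obtain ⟨f, hfC, hyf⟩ := hU.exists_basicOpen_le (V := ⟨Cᶜ, hC.isOpen_compl⟩) ⟨(π y).pt, hyC⟩ hy
      exact (CPoints.pt_mem_basicOpen_iff f hy).mp hyf
        (h _ ⟨f, Set.disjoint_left.mpr fun z hz => hfC hz, rfl⟩)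

variable [FiniteDimensional ℂ V] {L : FirstOrder.Language} [L.Structure ℝ]

/-- Definability of the restriction speaks of affine opens only. By Noetherianity the complement of
Z comes from a finite union of these. -/
theorem IsDefinableRestrict.definableIn_diff (hL : IsOMinimalExpansion L)
    [LocallyOfFiniteType G.hom] [QuasiCompact G.hom] {F : Set V}
    (hF : IsDefinableRestrict L π F) {Z : Set (CPoints G)}
    (hZ : @IsClosed _ (zariskiTopology G) Z) : DefinableIn L (F \ π ⁻¹' Z) := by
  let := zariskiTopology G
  have := FiniteDimensional.complexToReal V
  have := isNoetherian_left (G := G)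
  have hi : Topology.IsInducing (CPoints.pt (G := G)) := ⟨rfl⟩
  obtain ⟨C, hC, rfl⟩ := hi.isClosed_iff.mp hZ
  have hcpt : IsCompact (Cᶜ : Set G.left) := TopologicalSpace.NoetherianSpace.isCompact _
  obtain ⟨s, hs, hsU⟩ := (isCompact_and_isOpen_iff_finite_and_eq_biUnion_affineOpens).mp
    ⟨hcpt, hC.isOpen_compl⟩
  convert hL.definableIn_biUnion hs (fun U _ => (hF.2 U U.2).1) using 1
  ext v
  have : (π v).pt ∉ C ↔ ∃ U ∈ s, (π v).pt ∈ (U : G.left.Opens) := by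
    rw [← Set.mem_compl_iff, hsU]
    simp
  simp [this]

end Analytic

end OMinFlow

end

noncomputable section

namespace OMinFlow

open Filter Topology

/-! ### The identity principle for connected analytic submanifolds -/

section IdentityPrinciple

variable {V : Type*} [NormedAddCommGroup V] [NormedSpace ℂ V] [CompleteSpace V]

/-- If an analytic map on a connected set maps a neighbourhood of some point into an analytic set,
then it maps everything into that set. -/
theorem IsAnalyticSet.mem_of_eventually_mem {E : Type*} [NormedAddCommGroup E] [NormedSpace ℝ E]
    {A : Set V} (hA : IsAnalyticSet A) {f : E → V} {B : Set E} (hf : AnalyticOnNhd ℝ f B)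
    (hB : IsPreconnected B) {x₀ : E} (hx₀ : x₀ ∈ B) (h₀ : ∀ᶠ x in 𝓝 x₀, f x ∈ A) {x : E}
    (hx : x ∈ B) : ∀ᶠ y in 𝓝 x, f y ∈ A := by
  set u : Set E := {x | ∀ᶠ y in 𝓝 x, f y ∈ A} with hu
  suffices h : B ⊆ u from h hx
  refine hB.subset_of_closure_inter_subset isOpen_setOfPred_eventually_nhds ⟨x₀, hx₀, h₀⟩ ?_
  rintro x ⟨hxu, hxB⟩
  obtain ⟨N, hN, hxN, H, hH, hHN⟩ := hA (f x)
  have hev : ∀ᶠ y in 𝓝 x, AnalyticAt ℝ f y ∧ f y ∈ N :=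
    (hf x hxB).eventually_analyticAt.and ((hf x hxB).continuousAt.eventually (hN.mem_nhds hxN))
  obtain ⟨r, hr, hball⟩ := Metric.eventually_nhds_iff_ball.mp hev
  -- The local equations composed with f are analytic on the whole ball and vanish near z, hence
  -- vanish on the ball. So `u` is relatively closed in `B`.
  obtain ⟨z, hz, hzu⟩ := mem_closure_iff_nhds.mp hxu _ (Metric.ball_mem_nhds x hr)
  filter_upwards [Metric.ball_mem_nhds x hr] with y hy
  refine (hHN _ (hball y hy).2).mpr fun h hh => ?_
  have hana : AnalyticOnNhd ℝ (h ∘ f) (Metric.ball x r) := fun w hw =>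
    ((hH h hh _ (hball w hw).2).restrictScalars).comp (hball w hw).1
  have hzero : h ∘ f =ᶠ[𝓝 z] 0 := by
    filter_upwards [hzu, Metric.isOpen_ball.mem_nhds hz] with w hw hwB
    exact (hHN _ (hball w hwB).2).mp hw h hh
  exact hana.eqOn_zero_of_preconnected_of_eventuallyEq_zero
    (convex_ball x r).isPreconnected hz hzero hy

/-- The relative interior of A in X is also closed in X: at a limit point, a chart parametrizes X by
a ball in a linear subspace, where the identity principle applies. Connectedness of X concludes. -/
theorem IsAnalyticSubmanifold.subset_of_inter_subset {X : Set V} (hX : IsAnalyticSubmanifold X)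
    (hconn : IsPreconnected X) {A : Set V} (hA : IsAnalyticSet A) {O : Set V} (hO : IsOpen O)
    (hne : (X ∩ O).Nonempty) (hsub : X ∩ O ⊆ A) : X ⊆ A := by
  have := isPreconnected_iff_preconnectedSpace.mp hconn
  set S : Set X := interior (Subtype.val ⁻¹' A) with hS
  have hmem : ∀ Q : Set V, IsOpen Q → X ∩ Q ⊆ A → ∀ x : X, (x : V) ∈ Q → x ∈ S := by
    intro Q hQ hQA x hx
    refine mem_interior.mpr ⟨Subtype.val ⁻¹' Q, fun y hy => hQA ⟨y.2, hy⟩,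
      hQ.preimage continuous_subtype_val, hx⟩
  have hclosed : IsClosed S := by
    refine isClosed_of_closure_subset fun x hx => ?_
    obtain ⟨φ, W, hxφ, hφ, hφs, hXφ⟩ := hX x x.2
    have hXW : ∀ y ∈ φ.source, y ∈ X ↔ φ y ∈ W := by
      intro y hy
      have := Set.ext_iff.mp hXφ y
      simpa [hy] using this
    obtain ⟨r, hr, hball⟩ := Metric.isOpen_iff.mp φ.open_target _ (φ.map_source hxφ)
    have hNo : IsOpen (φ.source ∩ φ ⁻¹' Metric.ball (φ x) r) :=
      φ.isOpen_inter_preimage Metric.isOpen_ball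
    obtain ⟨s, hsN, hsS⟩ := mem_closure_iff.mp hx (Subtype.val ⁻¹' _)
      (hNo.preimage continuous_subtype_val) ⟨hxφ, Metric.mem_ball_self hr⟩
    obtain ⟨T, hTA, hTo, hsT⟩ := mem_interior.mp hsS
    obtain ⟨Q, hQ, rfl⟩ := isOpen_induced_iff.mp hTo
    let c : W := ⟨φ x, (hXW x hxφ).mp x.2⟩
    let w₀ : W := ⟨φ s, (hXW s hsN.1).mp s.2⟩
    let f : W → V := fun w => φ.symm w
    have hf : AnalyticOnNhd ℝ f (Metric.ball c r) := fun w hw =>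
      (hφs w (hball hw)).comp (W.subtypeL.analyticAt w)
    have hw₀ : w₀ ∈ Metric.ball c r := hsN.2
    have hev : ∀ᶠ w in 𝓝 w₀, f w ∈ A := by
      have hfs : f w₀ = s := φ.left_inv hsN.1
      have hQs : ∀ᶠ w in 𝓝 w₀, f w ∈ Q :=
        (hf w₀ hw₀).continuousAt.eventually (hQ.mem_nhds (by rw [hfs]; exact hsT))
      filter_upwards [hQs, Metric.isOpen_ball.mem_nhds hw₀] with w hw hwb
      have hwt : (w : V) ∈ φ.target := hball hwb
      have hwX : f w ∈ X := by
        rw [hXW _ (φ.map_target hwt), φ.right_inv hwt]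
        exact w.2
      exact hTA (a := ⟨f w, hwX⟩) hw
    refine hmem _ hNo ?_ x ⟨hxφ, Metric.mem_ball_self hr⟩
    rintro y ⟨hyX, hyφ, hyb⟩
    have := (hA.mem_of_eventually_mem hf (convex_ball c r).isPreconnected hw₀ hev
      (x := ⟨φ y, (hXW y hyφ).mp hyX⟩) hyb).self_of_nhds
    simpa [f, φ.left_inv hyφ] using this
  obtain ⟨p, hpX, hpO⟩ := hne
  have huniv : S = Set.univ := IsClopen.eq_univ ⟨hclosed, isOpen_interior⟩
    ⟨⟨p, hpX⟩, hmem O hO hsub _ hpO⟩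
  intro x hx
  have : (⟨x, hx⟩ : X) ∈ S := huniv ▸ Set.mem_univ _
  exact interior_subset (s := Subtype.val ⁻¹' A) this

end IdentityPrinciple

end OMinFlow

end

noncomputable section

namespace OMinFlow

open Filter Topology

/-! ### Holomorphic functions of polynomial growth off a hypersurface -/

section Growth

/-- A holomorphic function off a finite set that is locally bounded extends to an entire function;
here with a global polynomial bound. -/
theorem exists_differentiable_extension {u : ℂ → ℂ} {S : Set ℂ} (hS : S.Finite)
    (hd : DifferentiableOn ℂ u Sᶜ) {C : ℝ} {N : ℕ} (hb : ∀ z ∉ S, ‖u z‖ ≤ C * (1 + ‖z‖) ^ N) :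
    ∃ w : ℂ → ℂ, Differentiable ℂ w ∧ (∀ z ∉ S, w z = u z) ∧
      ∀ z, ‖w z‖ ≤ C * (1 + ‖z‖) ^ N := by
  classical
  let w : ℂ → ℂ := fun z => if z ∈ S then limUnder (𝓝[≠] z) u else u z
  have hwu : ∀ z ∉ S, w z = u z := fun z hz => if_neg hz
  have hdiff : Differentiable ℂ w := by
    intro a
    have hSa : (S \ {a})ᶜ ∈ 𝓝 a :=
      (hS.subset Set.sdiff_subset).isClosed.isOpen_compl.mem_nhds (by simp)
    by_cases ha : a ∈ S
    · have hnhds : (S \ {a})ᶜ ∩ Metric.ball a 1 ∈ 𝓝 a :=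
        inter_mem hSa (Metric.ball_mem_nhds a one_pos)
      have hout : ∀ z ∈ ((S \ {a})ᶜ ∩ Metric.ball a 1) \ {a}, z ∉ S := by
        rintro z ⟨⟨hz, -⟩, hza⟩ hzS
        exact hz ⟨hzS, hza⟩
      have key := Complex.differentiableOn_update_limUnder_of_bddAbove hnhds
        (hd.mono hout) ?_
      · refine (key.differentiableAt hnhds).congr_of_eventuallyEq ?_
        filter_upwards [hnhds] with z hz
        by_cases hza : z = a
        · subst hza
          simp [w, ha]
        · rw [Function.update_of_ne hza, hwu z (hout z ⟨hz, hza⟩)]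
      · refine ⟨|C| * (1 + (‖a‖ + 1)) ^ N, ?_⟩
        rintro _ ⟨z, hz, rfl⟩
        refine (hb z (hout z hz)).trans ?_
        have hza : ‖z‖ ≤ ‖a‖ + 1 := by
          have h1 : ‖z - a‖ < 1 := by simpa [dist_eq_norm] using hz.1.2
          linarith [norm_le_norm_add_norm_sub a z, norm_sub_rev a z]
        gcongr
        exact le_abs_self C
    · have hSo : Sᶜ ∈ 𝓝 a := hS.isClosed.isOpen_compl.mem_nhds ha
      refine (hd.differentiableAt hSo).congr_of_eventuallyEq ?_
      filter_upwards [hSo] with z hz using hwu z hz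
  refine ⟨w, hdiff, hwu, fun z => ?_⟩
  have hcl : IsClosed {z : ℂ | ‖w z‖ ≤ C * (1 + ‖z‖) ^ N} :=
    isClosed_le hdiff.continuous.norm (by fun_prop)
  have hdense : Dense Sᶜ := hS.countable.dense_compl ℂ
  exact hcl.closure_subset_iff.mpr (fun z hz => by rw [Set.mem_ofPred_eq, hwu z hz]; exact hb z hz)
    (hdense z)

/-- Liouville's argument: Cauchy's estimate on the circle of radius R ≥ 1 gives a bound of order 1/R
when k > N, and R tends to infinity. -/
theorem hasFPowerSeriesAt_coeff_eq_zero {w : ℂ → ℂ} (hw : Differentiable ℂ w) {C : ℝ} {N : ℕ}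
    (hb : ∀ z, ‖w z‖ ≤ C * (1 + ‖z‖) ^ N) {P : FormalMultilinearSeries ℂ ℂ ℂ}
    (hP : HasFPowerSeriesAt w P 0) {k : ℕ} (hk : N < k) : P k = 0 := by
  have hC : 0 ≤ C := by simpa using (norm_nonneg _).trans (hb 0)
  have hle : ∀ R : ℝ, 1 ≤ R → ‖P k‖ ≤ C * 2 ^ N * R⁻¹ := by
    intro R hR
    have hR0 : 0 < R := by linarith
    lift R to NNReal using hR0.le
    have hball := hw.hasFPowerSeriesOnBall 0 (R := R) (by exact_mod_cast hR0)
    rw [hP.eq_formalMultilinearSeries hball.hasFPowerSeriesAt]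
    have h1 : ‖cauchyPowerSeries w 0 R k‖ ≤ C * (1 + R) ^ N * (R : ℝ)⁻¹ ^ k := by
      refine (norm_cauchyPowerSeries_le w 0 R k).trans ?_
      rw [abs_of_nonneg hR0.le]
      refine mul_le_mul_of_nonneg_right ?_ (by positivity)
      have hint : (∫ θ in (0 : ℝ)..2 * Real.pi, ‖w (circleMap 0 R θ)‖) ≤
          (C * (1 + R) ^ N) * (2 * Real.pi) := by
        have := intervalIntegral.norm_integral_le_of_norm_le_const (a := 0) (b := 2 * Real.pi)
          (f := fun θ => ‖w (circleMap 0 R θ)‖) (C := C * (1 + R) ^ N) ?_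
        · refine (le_abs_self _).trans ?_
          simpa [abs_of_pos Real.pi_pos] using this
        · intro θ _
          simpa using hb (circleMap 0 R θ)
      have hpi : 0 < 2 * Real.pi := by positivity
      rw [inv_mul_le_iff₀ hpi]
      linarith
    refine h1.trans ?_
    have h2 : (1 + (R : ℝ)) ^ N ≤ 2 ^ N * (R : ℝ) ^ N := by
      rw [← mul_pow]
      gcongr
      linarith
    have h3 : (R : ℝ) ^ N * (R : ℝ)⁻¹ ^ k ≤ (R : ℝ)⁻¹ := by
      obtain ⟨j, rfl⟩ := Nat.exists_eq_add_of_lt hk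
      have : (R : ℝ) ^ N * (R : ℝ)⁻¹ ^ (N + j + 1) = (R : ℝ)⁻¹ ^ j * (R : ℝ)⁻¹ := by
        have hRN : (R : ℝ) ^ N * (R : ℝ)⁻¹ ^ N = 1 := by
          rw [← mul_pow, mul_inv_cancel₀ hR0.ne', one_pow]
        rw [pow_succ, pow_add, ← mul_assoc, ← mul_assoc, hRN, one_mul]
      rw [this]
      exact mul_le_of_le_one_left (by positivity)
        (pow_le_one₀ (by positivity) (inv_le_one_of_one_le₀ hR))
    calc C * (1 + (R : ℝ)) ^ N * (R : ℝ)⁻¹ ^ k ≤ C * (2 ^ N * (R : ℝ) ^ N) * (R : ℝ)⁻¹ ^ k := by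
          gcongr
      _ = C * 2 ^ N * ((R : ℝ) ^ N * (R : ℝ)⁻¹ ^ k) := by ring
      _ ≤ C * 2 ^ N * (R : ℝ)⁻¹ := by gcongr
  have hlim : Tendsto (fun R : ℝ => C * 2 ^ N * R⁻¹) atTop (𝓝 0) := by
    simpa using tendsto_inv_atTop_zero.const_mul (C * 2 ^ N)
  have : ‖P k‖ ≤ 0 := ge_of_tendsto hlim (eventually_atTop.mpr ⟨1, hle⟩)
  exact norm_le_zero_iff.mp this

/-- Used for the restriction of a function to a complex line, parametrized so that the base point is
at 0 and the target point at 1. -/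
theorem eq_sum_of_polynomial_growth {u : ℂ → ℂ} {S : Set ℂ} (hS : S.Finite)
    (hd : DifferentiableOn ℂ u Sᶜ) {C : ℝ} {N : ℕ} (hb : ∀ z ∉ S, ‖u z‖ ≤ C * (1 + ‖z‖) ^ N)
    (h0 : (0 : ℂ) ∉ S) (h1 : (1 : ℂ) ∉ S) {P : FormalMultilinearSeries ℂ ℂ ℂ}
    (hP : HasFPowerSeriesAt u P 0) : u 1 = ∑ k ∈ Finset.range (N + 1), P k fun _ => 1 := by
  obtain ⟨w, hw, hwu, hwb⟩ := exists_differentiable_extension hS hd hb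
  have hPw : HasFPowerSeriesAt w P 0 := by
    refine hP.congr ?_
    filter_upwards [hS.isClosed.isOpen_compl.mem_nhds h0] with z hz using (hwu z hz).symm
  have hball := hw.hasFPowerSeriesOnBall 0 (R := 2) (by norm_num)
  rw [← hPw.eq_formalMultilinearSeries hball.hasFPowerSeriesAt] at hball
  have hsum := hball.hasSum (y := 1) (by simp)
  rw [zero_add, hwu 1 h1] at hsum
  refine hsum.unique (hasSum_sum_of_ne_finset_zero fun k hk => ?_)
  rw [hasFPowerSeriesAt_coeff_eq_zero hw hwb hPw (by simpa using hk)]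
  simp

theorem exists_mvPolynomial_eq_diagonal {d k : ℕ}
    (f : ContinuousMultilinearMap ℂ (fun _ : Fin k => Fin d → ℂ) ℂ) :
    ∃ q : MvPolynomial (Fin d) ℂ, ∀ y, f (fun _ => y) = MvPolynomial.eval y q := by
  refine ⟨∑ r : Fin k → Fin d, (∏ i, MvPolynomial.X (r i)) *
    MvPolynomial.C (f fun i => Pi.single (r i) 1), fun y => ?_⟩
  have hy : y = ∑ j, y j • (Pi.single j 1 : Fin d → ℂ) := by
    simpa using pi_eq_sum_univ' y
  conv_lhs => rw [hy]
  have := f.toMultilinearMap.map_sum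
    (g := fun (_ : Fin k) (j : Fin d) => y j • (Pi.single j 1 : Fin d → ℂ))
  refine this.trans ?_
  rw [map_sum]
  refine Finset.sum_congr rfl fun r _ => ?_
  rw [MultilinearMap.map_smul_univ]
  simp

theorem MvPolynomial.exists_eval_ne_zero {σ : Type*} {δ : MvPolynomial σ ℂ} (hδ : δ ≠ 0) :
    ∃ x, MvPolynomial.eval x δ ≠ 0 := by
  by_contra! h
  exact hδ (MvPolynomial.funext fun x => by simpa using h x)

theorem finite_setOf_eval_line_eq_zero {d : ℕ} {δ : MvPolynomial (Fin d) ℂ} {x y : Fin d → ℂ}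
    (hx : MvPolynomial.eval x δ ≠ 0) : {t : ℂ | MvPolynomial.eval (x + t • y) δ = 0}.Finite := by
  let p : Polynomial ℂ := MvPolynomial.aeval
    (fun i => Polynomial.C (x i) + Polynomial.C (y i) * Polynomial.X) δ
  have hp : ∀ t, p.eval t = MvPolynomial.eval (x + t • y) δ := by
    intro t
    have := MvPolynomial.map_aeval
      (fun i => Polynomial.C (x i) + Polynomial.C (y i) * Polynomial.X) (Polynomial.evalRingHom t) δ
    rw [Polynomial.coe_evalRingHom] at this
    rw [this]
    have hC : (Polynomial.evalRingHom t).comp (algebraMap ℂ (Polynomial ℂ)) = RingHom.id ℂ := by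
      ext z
      simp
    rw [hC]
    change MvPolynomial.eval _ δ = _
    congr 2
    ext i
    simp [mul_comm (y i)]
  have hp0 : p ≠ 0 := by
    intro h
    apply hx
    have := hp 0
    rw [h] at this
    simpa using this.symm
  refine (Polynomial.finite_setOfPred_isRoot hp0).subset fun t ht => ?_
  simpa [Polynomial.IsRoot, hp] using ht

/-- A holomorphic function of polynomial growth on the complement of a hypersurface in `ℂᵈ` is a
polynomial. -/
theorem exists_mvPolynomial_eq_of_growth {d : ℕ} {δ : MvPolynomial (Fin d) ℂ} (hδ : δ ≠ 0)
    {g : (Fin d → ℂ) → ℂ} (hg : AnalyticOnNhd ℂ g {x | MvPolynomial.eval x δ ≠ 0}) {C : ℝ} {N : ℕ}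
    (hb : ∀ x, MvPolynomial.eval x δ ≠ 0 → ‖g x‖ ≤ C * (1 + ‖x‖) ^ N) :
    ∃ q : MvPolynomial (Fin d) ℂ, ∀ x, MvPolynomial.eval x δ ≠ 0 → g x = MvPolynomial.eval x q := by
  obtain ⟨x₀, hx₀⟩ := MvPolynomial.exists_eval_ne_zero hδ
  obtain ⟨P, hP⟩ := hg x₀ hx₀
  choose q hq using fun k => exists_mvPolynomial_eq_diagonal (P k)
  refine ⟨MvPolynomial.bind₁ (fun i => MvPolynomial.X i - MvPolynomial.C (x₀ i))
    (∑ k ∈ Finset.range (N + 1), q k), fun x hx => ?_⟩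
  -- On the line from x₀ to x the series at x₀ stops at degree N. Since N does not depend on the
  -- line, a single polynomial serves for all x.
  set y := x - x₀ with hy
  have hS := finite_setOf_eval_line_eq_zero (y := y) hx₀
  set S := {t : ℂ | MvPolynomial.eval (x₀ + t • y) δ = 0} with hSdef
  let ℓ : ℂ →L[ℂ] (Fin d → ℂ) := ContinuousLinearMap.toSpanSingleton ℂ y
  have hℓ : ∀ t, ℓ t = t • y := fun t => rfl
  have hu : HasFPowerSeriesAt (fun t : ℂ => g (x₀ + t • y)) (P.compContinuousLinearMap ℓ) 0 := by
    have h1 : HasFPowerSeriesAt (fun z => g (x₀ + z)) P (ℓ 0) := by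
      have := hP.comp_sub (-x₀)
      simpa [sub_neg_eq_add, add_comm] using this
    exact h1.compContinuousLinearMap
  have hC : 0 ≤ C := by
    by_contra hC
    have := (norm_nonneg _).trans (hb x₀ hx₀)
    have h2 : 0 < (1 + ‖x₀‖) ^ N := by positivity
    nlinarith
  -- The constant comes from 1 + ‖x₀ + t y‖ ≤ (1 + ‖x₀‖ + ‖y‖)(1 + ‖t‖); only it, not the exponent,
  -- depends on x.
  have key := eq_sum_of_polynomial_growth hS (u := fun t : ℂ => g (x₀ + t • y))
    (C := C * (1 + ‖x₀‖ + ‖y‖) ^ N) (N := N) ?_ ?_ (by simpa [hSdef] using hx₀)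
    (by simpa [hSdef, hy] using hx) hu
  · have hgx : g x = g (x₀ + (1 : ℂ) • y) := by simp [hy]
    have hev : ∀ p : MvPolynomial (Fin d) ℂ, MvPolynomial.eval x (MvPolynomial.bind₁
        (fun i => MvPolynomial.X i - MvPolynomial.C (x₀ i)) p) = MvPolynomial.eval y p := by
      intro p
      induction p using MvPolynomial.induction_on with
      | C a => simp
      | add p q hp hq => simp [hp, hq]
      | mul_X p i hp => simp [hp, hy]
    rw [hgx, key, hev, map_sum]
    refine Finset.sum_congr rfl fun k _ => ?_
    rw [← hq k]
    simp [FormalMultilinearSeries.compContinuousLinearMap, ℓ]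
  · intro t ht
    have hline : DifferentiableAt ℂ (fun t : ℂ => x₀ + t • y) t := by fun_prop
    exact ((hg _ ht).differentiableAt.comp t hline).differentiableWithinAt
  · intro t ht
    refine (hb _ ht).trans ?_
    rw [mul_assoc, ← mul_pow]
    gcongr
    have := norm_add_le x₀ (t • y)
    rw [norm_smul] at this
    nlinarith [norm_nonneg x₀, norm_nonneg y, norm_nonneg t,
      mul_nonneg (norm_nonneg t) (norm_nonneg x₀)]

end Growth

end OMinFlow

end

noncomputable section

namespace OMinFlow

open Filter Topology Polynomial

/-! ### Monodromy of an irreducible polynomial with polynomial coefficients -/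

section Branches

variable {d : ℕ}

/-- The polynomial in one variable obtained by evaluating the coefficients at a point. -/
abbrev specialize (P : (MvPolynomial (Fin d) ℂ)[X]) (x : Fin d → ℂ) : ℂ[X] :=
  P.map (MvPolynomial.eval x)

theorem eval_specialize (P : (MvPolynomial (Fin d) ℂ)[X]) (x : Fin d → ℂ) (t : ℂ) :
    (specialize P x).eval t =
      ∑ k ∈ Finset.range (P.natDegree + 1), MvPolynomial.eval x (P.coeff k) * t ^ k := by
  rw [Polynomial.eval_map, Polynomial.eval₂_eq_sum_range]

theorem analyticAt_mvPolynomial_eval (p : MvPolynomial (Fin d) ℂ) (x : Fin d → ℂ) :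
    AnalyticAt ℂ (fun x => MvPolynomial.eval x p) x := by
  induction p using MvPolynomial.induction_on with
  | C a => simpa using analyticAt_const
  | add p q hp hq => simpa using hp.fun_add hq
  | mul_X p i hp =>
    simpa using hp.fun_mul
      ((ContinuousLinearMap.proj (R := ℂ) (φ := fun _ : Fin d => ℂ) i).analyticAt x)

theorem analyticAt_specialize (P : (MvPolynomial (Fin d) ℂ)[X]) (q : (Fin d → ℂ) × ℂ) :
    AnalyticAt ℂ (fun q : (Fin d → ℂ) × ℂ => (specialize P q.1).eval q.2) q := by
  simp only [eval_specialize]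
  refine Finset.analyticAt_fun_sum _ fun k _ => AnalyticAt.mul ?_ (analyticAt_snd.pow k)
  exact (analyticAt_mvPolynomial_eval (P.coeff k) q.1).comp analyticAt_fst

/-- Around a simple root, the roots of a polynomial with analytic coefficients are given by an
analytic function. -/
theorem exists_branch (P : (MvPolynomial (Fin d) ℂ)[X]) {x₀ : Fin d → ℂ} {t₀ : ℂ}
    (h0 : (specialize P x₀).eval t₀ = 0) (h1 : (specialize P x₀).derivative.eval t₀ ≠ 0) :
    ∃ τ : (Fin d → ℂ) → ℂ, AnalyticAt ℂ τ x₀ ∧ τ x₀ = t₀ ∧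
      (∀ᶠ x in 𝓝 x₀, (specialize P x).eval (τ x) = 0) ∧
      ∀ᶠ q in 𝓝 (x₀, t₀), (specialize P q.1).eval q.2 = 0 ↔ τ q.1 = q.2 := by
  let f : (Fin d → ℂ) × ℂ → ℂ := fun q => (specialize P q.1).eval q.2
  have hf : ContDiffAt ℂ ⊤ f (x₀, t₀) := (analyticAt_specialize P _).contDiffAt
  -- The partial derivative in t is multiplication by the nonzero number in `h1`, as the implicit
  -- function theorem requires.
  have hinv : (fderiv ℂ f (x₀, t₀) ∘L .inr ℂ (Fin d → ℂ) ℂ).IsInvertible := by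
    have hd : HasDerivAt (fun t => f (x₀, t)) ((specialize P x₀).derivative.eval t₀) t₀ :=
      (specialize P x₀).hasDerivAt t₀
    have hc : HasDerivAt (fun t => f (x₀, t))
        ((fderiv ℂ f (x₀, t₀) ∘L .inr ℂ (Fin d → ℂ) ℂ) 1) t₀ := by
      have h2 : HasFDerivAt (fun t : ℂ => (x₀, t)) (ContinuousLinearMap.inr ℂ (Fin d → ℂ) ℂ) t₀ :=
        hasFDerivAt_prodMk_right x₀ t₀
      exact (HasFDerivAt.comp t₀
        (analyticAt_specialize P (x₀, t₀)).differentiableAt.hasFDerivAt h2).hasDerivAt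
    have hval := hd.unique hc
    rw [hval] at h1
    refine ⟨ContinuousLinearEquiv.unitsEquivAut ℂ (Units.mk0 _ h1), ?_⟩
    ext
    simp
  refine ⟨hf.implicitFunction (by simp) hinv, ?_, hf.implicitFunction_apply_self _ hinv, ?_, ?_⟩
  · exact (hf.contDiffAt_implicitFunction (by simp) hinv).analyticAt
  · have := hf.eventually_apply_implicitFunction (by simp) hinv
    filter_upwards [this] with x hx
    exact hx.trans h0
  · have := hf.eventually_apply_eq_iff_implicitFunction (by simp) hinv
    filter_upwards [this] with q hq
    rw [← hq]
    change _ ↔ (specialize P q.1).eval q.2 = (specialize P x₀).eval t₀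
    rw [h0]

theorem derivative_eval_ne_zero_of_separable {p : ℂ[X]} (hp : p.Separable) {t : ℂ}
    (ht : p.eval t = 0) : p.derivative.eval t ≠ 0 := by
  intro h
  obtain ⟨a, b, hab⟩ := hp
  simpa [ht, h] using congrArg (Polynomial.eval t) hab

/-- A continuous branch of simple roots exhausts the nearby roots. -/
theorem eventually_eq_branch (P : (MvPolynomial (Fin d) ℂ)[X]) {x₀ : Fin d → ℂ}
    (hsep : (specialize P x₀).Separable) {τ : (Fin d → ℂ) → ℂ} (hτ : ContinuousAt τ x₀)
    (hroot : ∀ᶠ x in 𝓝 x₀, (specialize P x).eval (τ x) = 0) :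
    ∀ᶠ q in 𝓝 (x₀, τ x₀), (specialize P q.1).eval q.2 = 0 → q.2 = τ q.1 := by
  have h0 := hroot.self_of_nhds
  obtain ⟨σ, -, -, -, hσ⟩ := exists_branch P h0 (derivative_eval_ne_zero_of_separable hsep h0)
  have h1 : ∀ᶠ x in 𝓝 x₀, σ x = τ x := by
    have hc : Tendsto (fun x => (x, τ x)) (𝓝 x₀) (𝓝 (x₀, τ x₀)) :=
      (continuousAt_id.prodMk hτ).tendsto
    filter_upwards [hc.eventually hσ, hroot] with x hx hr using hx.mp hr
  have h2 : ∀ᶠ q : (Fin d → ℂ) × ℂ in 𝓝 (x₀, τ x₀), σ q.1 = τ q.1 :=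
    (continuous_fst.tendsto (x₀, τ x₀)).eventually h1
  filter_upwards [hσ, h2] with q hq hq2 hr
  rw [← hq2, hq.mp hr]

/-- Near a point where the specialization is separable, the roots are given by finitely many
analytic branches. -/
theorem exists_branches (P : (MvPolynomial (Fin d) ℂ)[X]) (hP : P.Monic) {x₀ : Fin d → ℂ}
    (hsep : (specialize P x₀).Separable) :
    ∃ τ : ℂ → (Fin d → ℂ) → ℂ, (∀ t ∈ (specialize P x₀).roots.toFinset,
        AnalyticAt ℂ (τ t) x₀ ∧ τ t x₀ = t ∧ ∀ᶠ x in 𝓝 x₀, (specialize P x).eval (τ t x) = 0) ∧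
      ∀ᶠ x in 𝓝 x₀, (specialize P x).roots.toFinset =
          (specialize P x₀).roots.toFinset.image (fun t => τ t x) ∧
        Set.InjOn (fun t => τ t x) ((specialize P x₀).roots.toFinset : Set ℂ) := by
  classical
  have hne : ∀ x, specialize P x ≠ 0 := fun x => (hP.map _).ne_zero
  set Z := (specialize P x₀).roots.toFinset with hZ
  have hbr : ∀ t, ∃ τ : (Fin d → ℂ) → ℂ, t ∈ Z → AnalyticAt ℂ τ x₀ ∧ τ x₀ = t ∧
      ∀ᶠ x in 𝓝 x₀, (specialize P x).eval (τ x) = 0 := by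
    intro t
    by_cases ht : t ∈ Z
    · have ht0 : (specialize P x₀).eval t = 0 := by
        have := (Polynomial.mem_roots (hne x₀)).mp (Multiset.mem_toFinset.mp ht)
        exact this
      obtain ⟨τ, h1, h2, h3, -⟩ :=
        exists_branch P ht0 (derivative_eval_ne_zero_of_separable hsep ht0)
      exact ⟨τ, fun _ => ⟨h1, h2, h3⟩⟩
    · exact ⟨fun _ => 0, fun h => absurd h ht⟩
  choose τ hτ using hbr
  refine ⟨τ, hτ, ?_⟩
  have hinj : ∀ᶠ x in 𝓝 x₀, ∀ t ∈ Z, ∀ s ∈ Z, t ≠ s → τ t x ≠ τ s x := by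
    simp only [Finset.eventually_all]
    intro t ht s hs
    by_cases hts : t = s
    · simp [hts]
    · have hne₀ : τ t x₀ ≠ τ s x₀ := by rwa [(hτ t ht).2.1, (hτ s hs).2.1]
      filter_upwards [((hτ t ht).1.continuousAt.prodMk (hτ s hs).1.continuousAt).eventually
        (isOpen_ne_fun continuous_fst continuous_snd |>.mem_nhds hne₀)] with x hx _ using hx
  have hroots : ∀ᶠ x in 𝓝 x₀, ∀ t ∈ Z, (specialize P x).eval (τ t x) = 0 := by
    simp only [Finset.eventually_all]
    exact fun t ht => (hτ t ht).2.2
  filter_upwards [hinj, hroots] with x hxi hxr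
  have hinjOn : Set.InjOn (fun t => τ t x) (Z : Set ℂ) := fun t ht s hs h =>
    by_contra fun hts => hxi t ht s hs hts h
  -- The branches have distinct values, as many as the degree, so they exhaust the roots.
  refine ⟨(Finset.eq_of_subset_of_card_le ?_ ?_).symm, hinjOn⟩
  · intro s hs
    obtain ⟨t, ht, rfl⟩ := Finset.mem_image.mp hs
    rw [Multiset.mem_toFinset, Polynomial.mem_roots (hne x)]
    exact hxr t ht
  · rw [Finset.card_image_of_injOn hinjOn, hZ,
      Multiset.toFinset_card_of_nodup (Polynomial.nodup_roots hsep)]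
    refine (Multiset.toFinset_card_le _).trans ?_
    rw [IsAlgClosed.card_roots_eq_natDegree, IsAlgClosed.card_roots_eq_natDegree]
    simp [hP.natDegree_map]

theorem analyticAt_coeff_prod {E ι : Type*} [NormedAddCommGroup E] [NormedSpace ℂ E]
    (s : Finset ι) {τ : ι → E → ℂ} {x₀ : E} (hτ : ∀ i ∈ s, AnalyticAt ℂ (τ i) x₀) (k : ℕ) :
    AnalyticAt ℂ (fun x => (∏ i ∈ s, (X - C (τ i x))).coeff k) x₀ := by
  classical
  induction s using Finset.induction_on generalizing k with
  | empty => simpa using analyticAt_const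
  | insert a s ha ih =>
    simp only [Finset.prod_insert ha, sub_mul, coeff_sub, coeff_C_mul]
    have ih' := ih fun i hi => hτ i (Finset.mem_insert_of_mem hi)
    have h2 := (hτ a (Finset.mem_insert_self a s)).fun_mul (ih' k)
    cases k with
    | zero => simpa using h2.fun_neg
    | succ k => simpa only [coeff_X_mul] using (ih' k).fun_sub h2

theorem norm_coeff_prod_le {s : Finset ℂ} {R : ℝ} (hR : ∀ t ∈ s, ‖t‖ ≤ R) (hR0 : 0 ≤ R) (k : ℕ) :
    ‖(∏ t ∈ s, (X - C t)).coeff k‖ ≤ (1 + R) ^ s.card := by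
  classical
  induction s using Finset.induction_on generalizing k with
  | empty =>
    rw [Finset.prod_empty, coeff_one]
    split_ifs <;> simp
  | insert a s ha ih =>
    have ih' := ih fun t ht => hR t (Finset.mem_insert_of_mem ht)
    rw [Finset.prod_insert ha, Finset.card_insert_of_notMem ha, sub_mul, coeff_sub, coeff_C_mul]
    have h1 : ‖(X * ∏ t ∈ s, (X - C t)).coeff k‖ ≤ (1 + R) ^ s.card := by
      cases k with
      | zero => simp; positivity
      | succ k => simpa only [coeff_X_mul] using ih' k
    calc _ ≤ (1 + R) ^ s.card + R * (1 + R) ^ s.card := by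
          refine (norm_sub_le _ _).trans (add_le_add h1 ?_)
          rw [norm_mul]
          exact mul_le_mul (hR a (Finset.mem_insert_self a s)) (ih' k) (norm_nonneg _) hR0
      _ = _ := by ring

theorem exists_norm_eval_le (p : MvPolynomial (Fin d) ℂ) :
    ∃ (K : ℝ) (N : ℕ), 0 ≤ K ∧ ∀ x, ‖MvPolynomial.eval x p‖ ≤ K * (1 + ‖x‖) ^ N := by
  induction p using MvPolynomial.induction_on with
  | C a => exact ⟨‖a‖, 0, norm_nonneg _, by simp⟩
  | add p q hp hq =>
    obtain ⟨K, N, hK, h⟩ := hp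
    obtain ⟨K', N', hK', h'⟩ := hq
    refine ⟨K + K', max N N', add_nonneg hK hK', fun x => ?_⟩
    have h1 : (1 : ℝ) ≤ 1 + ‖x‖ := by linarith [norm_nonneg x]
    rw [map_add, add_mul]
    refine (norm_add_le _ _).trans (add_le_add ((h x).trans ?_) ((h' x).trans ?_))
    · gcongr
      exact le_max_left _ _
    · gcongr
      exact le_max_right _ _
  | mul_X p i hp =>
    obtain ⟨K, N, hK, h⟩ := hp
    refine ⟨K, N + 1, hK, fun x => ?_⟩
    rw [map_mul, MvPolynomial.eval_X, norm_mul, pow_succ, ← mul_assoc]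
    refine mul_le_mul (h x) ?_ (norm_nonneg _) (by positivity)
    linarith [norm_le_pi_norm x i]

/-- The roots of a monic polynomial with polynomial coefficients grow polynomially. -/
theorem exists_norm_root_le {P : (MvPolynomial (Fin d) ℂ)[X]} (hP : P.Monic) :
    ∃ (K : ℝ) (N : ℕ), 0 ≤ K ∧
      ∀ x t, (specialize P x).eval t = 0 → ‖t‖ ≤ K * (1 + ‖x‖) ^ N := by
  choose K N hK h using fun k => exists_norm_eval_le (P.coeff k)
  set m := P.natDegree with hm
  set M := ∑ k ∈ Finset.range m, N k with hM
  refine ⟨(∑ k ∈ Finset.range m, K k) + 1, M,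
    add_nonneg (Finset.sum_nonneg fun k _ => hK k) zero_le_one, fun x t ht => ?_⟩
  have h1 : (1 : ℝ) ≤ 1 + ‖x‖ := by linarith [norm_nonneg x]
  have hM1 : (1 : ℝ) ≤ (1 + ‖x‖) ^ M := one_le_pow₀ h1
  have hne : specialize P x ≠ 0 := (hP.map _).ne_zero
  have hb : ‖t‖ ≤ (specialize P x).cauchyBound := by
    exact_mod_cast (Polynomial.IsRoot.norm_lt_cauchyBound hne ht).le
  refine hb.trans ?_
  have hlead : (specialize P x).leadingCoeff = 1 := hP.map _
  have hdeg : (specialize P x).natDegree = m := hP.natDegree_map _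
  have hcb : (specialize P x).cauchyBound ≤
      ∑ k ∈ Finset.range m, ‖(specialize P x).coeff k‖₊ + 1 := by
    rw [Polynomial.cauchyBound, hlead, hdeg]
    simp only [nnnorm_one, div_one]
    gcongr
    exact Finset.sup_le fun k hk => Finset.single_le_sum
      (f := fun k => ‖(specialize P x).coeff k‖₊) (fun _ _ => zero_le) hk
  have hcb' : ((specialize P x).cauchyBound : ℝ) ≤
      ∑ k ∈ Finset.range m, ‖(specialize P x).coeff k‖ + 1 := by
    simpa using NNReal.coe_le_coe.mpr hcb
  refine hcb'.trans ?_
  rw [add_mul, one_mul, Finset.sum_mul]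
  refine add_le_add (Finset.sum_le_sum fun k hk => ?_) hM1
  rw [Polynomial.coeff_map]
  refine (h k x).trans ?_
  have hNM : N k ≤ M := Finset.single_le_sum (f := N) (fun _ _ => Nat.zero_le _) hk
  have := hK k
  gcongr

open Classical in
/-- The monic polynomial whose roots are the roots of a specialization that lie in a given set. -/
def partialProduct (P : (MvPolynomial (Fin d) ℂ)[X]) (A : Set ((Fin d → ℂ) × ℂ))
    (x : Fin d → ℂ) : ℂ[X] :=
  ∏ t ∈ (specialize P x).roots.toFinset with (x, t) ∈ A, (X - C t)

/-- A set of roots is invariant under analytic continuation over `δ ≠ 0`. -/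
def IsMonodromyInvariant (P : (MvPolynomial (Fin d) ℂ)[X]) (δ : MvPolynomial (Fin d) ℂ)
    (A : Set ((Fin d → ℂ) × ℂ)) : Prop :=
  ∀ x₀, MvPolynomial.eval x₀ δ ≠ 0 → ∀ τ : (Fin d → ℂ) → ℂ, AnalyticAt ℂ τ x₀ →
    (∀ᶠ x in 𝓝 x₀, (specialize P x).eval (τ x) = 0) →
    ∀ᶠ x in 𝓝 x₀, (x, τ x) ∈ A ↔ (x₀, τ x₀) ∈ A

theorem IsMonodromyInvariant.compl {P : (MvPolynomial (Fin d) ℂ)[X]}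
    {δ : MvPolynomial (Fin d) ℂ} {A : Set ((Fin d → ℂ) × ℂ)} (hA : IsMonodromyInvariant P δ A) :
    IsMonodromyInvariant P δ Aᶜ := fun x₀ hx₀ τ hτ hr => by
  filter_upwards [hA x₀ hx₀ τ hτ hr] with x hx using not_congr hx

variable {P : (MvPolynomial (Fin d) ℂ)[X]} {δ : MvPolynomial (Fin d) ℂ}
  {A : Set ((Fin d → ℂ) × ℂ)}

/-- Locally the selected roots are a fixed set of analytic branches, so the coefficients of their
product are analytic off δ = 0. The growth bound on roots then makes them polynomials by
`exists_mvPolynomial_eq_of_growth`. -/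
theorem IsMonodromyInvariant.exists_eq_specialize (hP : P.Monic) (hδ : δ ≠ 0)
    (hsep : ∀ x, MvPolynomial.eval x δ ≠ 0 → (specialize P x).Separable)
    (hA : IsMonodromyInvariant P δ A) :
    ∃ Q : (MvPolynomial (Fin d) ℂ)[X], ∀ x, MvPolynomial.eval x δ ≠ 0 →
      specialize Q x = partialProduct P A x := by
  classical
  have hne : ∀ x, specialize P x ≠ 0 := fun x => (hP.map _).ne_zero
  have hdeg : ∀ x, (specialize P x).natDegree = P.natDegree := fun x => hP.natDegree_map _
  obtain ⟨K, N, hK, hroot⟩ := exists_norm_root_le hP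
  have hcard : ∀ x, ((specialize P x).roots.toFinset.filter (fun t => (x, t) ∈ A)).card ≤
      P.natDegree := fun x => by
    refine (Finset.card_filter_le _ _).trans ((Multiset.toFinset_card_le _).trans ?_)
    exact (Polynomial.card_roots' _).trans (hdeg x).le
  have hcoeff : ∀ k, ∃ q : MvPolynomial (Fin d) ℂ, ∀ x, MvPolynomial.eval x δ ≠ 0 →
      (partialProduct P A x).coeff k = MvPolynomial.eval x q := by
    intro k
    refine exists_mvPolynomial_eq_of_growth hδ (C := (1 + K) ^ P.natDegree)
      (N := N * P.natDegree) ?_ ?_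
    · intro x₀ hx₀
      obtain ⟨τ, hτ, hev⟩ := exists_branches P hP (hsep x₀ hx₀)
      have hmem : ∀ᶠ x in 𝓝 x₀, ∀ t ∈ (specialize P x₀).roots.toFinset,
          ((x, τ t x) ∈ A ↔ (x₀, t) ∈ A) := by
        rw [Finset.eventually_all]
        intro t ht
        have := hA x₀ hx₀ (τ t) (hτ t ht).1 (hτ t ht).2.2
        rwa [(hτ t ht).2.1] at this
      refine (analyticAt_coeff_prod
        ((specialize P x₀).roots.toFinset.filter (fun t => (x₀, t) ∈ A)) (τ := τ)
        (fun t ht => (hτ t (Finset.mem_filter.mp ht).1).1) k).congr ?_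
      filter_upwards [hev, hmem] with x hx hxA
      congr 1
      rw [partialProduct, hx.1, Finset.filter_image, Finset.prod_image]
      · refine Finset.prod_congr (Finset.filter_congr fun t ht => ?_) fun _ _ => rfl
        exact (hxA t ht).symm
      · exact hx.2.mono fun t ht => (Finset.mem_filter.mp ht).1
    · intro x _
      have hR : ∀ t ∈ (specialize P x).roots.toFinset.filter (fun t => (x, t) ∈ A),
          ‖t‖ ≤ K * (1 + ‖x‖) ^ N := by
        intro t ht
        refine hroot x t ?_
        exact (Polynomial.mem_roots (hne x)).mp (Multiset.mem_toFinset.mp (Finset.mem_filter.mp ht).1)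
      have h1 : (1 : ℝ) ≤ 1 + ‖x‖ := by linarith [norm_nonneg x]
      have h1N : (1 : ℝ) ≤ (1 + ‖x‖) ^ N := one_le_pow₀ h1
      have hR0 : 0 ≤ K * (1 + ‖x‖) ^ N := by positivity
      refine (norm_coeff_prod_le hR hR0 k).trans ?_
      refine (pow_le_pow_right₀ (by linarith) (hcard x)).trans ?_
      rw [pow_mul, ← mul_pow]
      gcongr
      linarith
  choose q hq using hcoeff
  refine ⟨∑ k ∈ Finset.range (P.natDegree + 1), monomial k (q k), fun x hx => ?_⟩
  ext k
  rw [coeff_map, finsetSum_coeff, map_sum]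
  simp only [coeff_monomial, apply_ite (MvPolynomial.eval x), map_zero]
  rw [Finset.sum_ite_eq' (Finset.range (P.natDegree + 1)) k]
  split_ifs with hk
  · exact (hq k x hx).symm
  · symm
    apply coeff_eq_zero_of_natDegree_lt
    rw [partialProduct, natDegree_prod_of_monic _ _ fun t _ => monic_X_sub_C t]
    simp only [natDegree_X_sub_C, Finset.sum_const, smul_eq_mul, mul_one]
    have := hcard x
    simp at hk
    omega

/-- The monodromy group of an irreducible polynomial is transitive on the roots. -/
theorem IsMonodromyInvariant.all_or_none (hP : P.Monic) (hirr : Irreducible P) (hδ : δ ≠ 0)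
    (hsep : ∀ x, MvPolynomial.eval x δ ≠ 0 → (specialize P x).Separable)
    (hA : IsMonodromyInvariant P δ A) :
    (∀ x t, MvPolynomial.eval x δ ≠ 0 → (specialize P x).eval t = 0 → (x, t) ∈ A) ∨
      ∀ x t, MvPolynomial.eval x δ ≠ 0 → (specialize P x).eval t = 0 → (x, t) ∉ A := by
  classical
  have hne : ∀ x, specialize P x ≠ 0 := fun x => (hP.map _).ne_zero
  obtain ⟨Q, hQ⟩ := hA.exists_eq_specialize hP hδ hsep
  obtain ⟨Q', hQ'⟩ := hA.compl.exists_eq_specialize hP hδ hsep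
  -- The selected and the unselected roots give complementary factors of P. One of them is a unit,
  -- and a unit has no roots.
  have hprod : P = Q * Q' := by
    have hspec : ∀ x, MvPolynomial.eval x δ ≠ 0 → specialize P x = specialize (Q * Q') x := by
      intro x hx
      rw [specialize, specialize, Polynomial.map_mul, ← specialize, ← specialize, ← specialize,
        hQ x hx, hQ' x hx, partialProduct, partialProduct]
      have hsplit := (Finset.prod_filter_mul_prod_filter_not (specialize P x).roots.toFinset
        (fun t => (x, t) ∈ A) (fun t => (X - C t : ℂ[X])))
      have hroots : ∏ t ∈ (specialize P x).roots.toFinset, (X - C t : ℂ[X]) = specialize P x := by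
        rw [Finset.prod, Multiset.toFinset_val,
          Multiset.dedup_eq_self.mpr (Polynomial.nodup_roots (hsep x hx))]
        exact Polynomial.prod_multiset_X_sub_C_of_monic_of_roots_card_eq (hP.map _)
          (IsAlgClosed.card_roots_eq_natDegree)
      rw [hroots] at hsplit
      convert hsplit.symm using 2
      exact Finset.prod_congr (by ext t; simp) fun _ _ => rfl
    ext1 k
    -- The factor δ makes the identity hold at every point, including those with δ = 0.
    have : δ * (P.coeff k - (Q * Q').coeff k) = 0 := by
      refine MvPolynomial.funext fun x => ?_
      by_cases hx : MvPolynomial.eval x δ = 0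
      · simp [hx]
      · have := congrArg (fun p => p.coeff k) (hspec x hx)
        simp only [specialize, coeff_map] at this
        simp [this]
    exact sub_eq_zero.mp ((mul_eq_zero.mp this).resolve_left hδ)
  have hunit : ∀ (B : Set ((Fin d → ℂ) × ℂ)) (R : (MvPolynomial (Fin d) ℂ)[X]),
      (∀ x, MvPolynomial.eval x δ ≠ 0 → specialize R x = partialProduct P B x) → IsUnit R →
      ∀ x t, MvPolynomial.eval x δ ≠ 0 → (specialize P x).eval t = 0 → (x, t) ∉ B := by
    intro B R hR hu x t hx ht htB
    have hux : IsUnit (partialProduct P B x) := by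
      rw [← hR x hx]
      exact hu.map (Polynomial.mapRingHom (MvPolynomial.eval x))
    have hdvd : (X - C t) ∣ partialProduct P B x := by
      rw [partialProduct]
      refine Finset.dvd_prod_of_mem (fun t => (X - C t : ℂ[X])) (Finset.mem_filter.mpr ⟨?_, htB⟩)
      rw [Multiset.mem_toFinset, Polynomial.mem_roots (hne x)]
      exact ht
    exact Polynomial.not_isUnit_X_sub_C t (isUnit_of_dvd_unit hdvd hux)
  rcases hirr.isUnit_or_isUnit hprod with h | h
  · exact Or.inr (hunit A Q hQ h)
  · refine Or.inl fun x t hx ht => ?_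
    simpa using hunit Aᶜ Q' hQ' h x t hx ht

end Branches

end OMinFlow

end

noncomputable section

namespace OMinFlow

open Polynomial

/-! ### Finite extensions of polynomial rings -/

section Primitive

attribute [local instance] FractionRing.liftAlgebra in
/-- A finite extension of domains of characteristic zero is generically generated by one
element, with a generically separable minimal polynomial. -/
theorem exists_generic_primitive_element (R B : Type*) [CommRing R] [IsDomain R]
    [IsIntegrallyClosed R] [CharZero R] [CommRing B] [IsDomain B] [Algebra R B] [FaithfulSMul R B]
    [Module.Finite R B] :
    ∃ θ : B, (∃ (δ : R) (u v : R[X]), δ ≠ 0 ∧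
        u * minpoly R θ + v * derivative (minpoly R θ) = C δ) ∧
      ∀ b : B, ∃ (r : R) (q : R[X]), r ≠ 0 ∧ algebraMap R B r * b = aeval θ q := by
  let K := FractionRing R
  let E := FractionRing B
  have : FiniteDimensional K E := .of_isLocalization R B (nonZeroDivisors R)
  have hRK : Function.Injective (algebraMap R K) := IsFractionRing.injective R K
  have hBE : Function.Injective (algebraMap B E) := IsFractionRing.injective B E
  obtain ⟨α, hα⟩ := Field.exists_primitive_element K E
  -- The fraction field of B needs only denominators from R, so a multiple of α by some r in R lies
  -- in B and is still primitive.
  obtain ⟨⟨θ, s⟩, hs⟩ := IsLocalization.surj (Algebra.algebraMapSubmonoid B (nonZeroDivisors R)) α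
  obtain ⟨r, hr, hrs⟩ := s.2
  have hr0 : r ≠ 0 := nonZeroDivisors.ne_zero hr
  have hrK : algebraMap R K r ≠ 0 := by simpa using hr0
  have hθ : algebraMap B E θ = algebraMap K E (algebraMap R K r) * α := by
    rw [← hs, ← hrs, ← IsScalarTower.algebraMap_apply, ← IsScalarTower.algebraMap_apply, mul_comm]
  have htop : Algebra.adjoin K {algebraMap B E θ} = ⊤ := by
    have h1 : (IntermediateField.adjoin K {algebraMap B E θ}) = ⊤ := by
      rw [eq_top_iff, ← hα, IntermediateField.adjoin_simple_le_iff]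
      have : α = (algebraMap K E (algebraMap R K r))⁻¹ * algebraMap B E θ := by
        rw [hθ, inv_mul_cancel_left₀]
        simpa using hr0
      rw [this, ← map_inv₀]
      exact mul_mem (IntermediateField.algebraMap_mem _ _)
        (IntermediateField.mem_adjoin_simple_self _ _)
    have h2 := IntermediateField.adjoin_simple_toSubalgebra_of_isAlgebraic
      (Algebra.IsAlgebraic.isAlgebraic (R := K) (algebraMap B E θ))
    rw [← h2, h1]
    rfl
  have hint : IsIntegral R θ := Algebra.IsIntegral.isIntegral θ
  refine ⟨θ, ?_, fun b => ?_⟩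
  -- As R is integrally closed, the minimal polynomials over R and K agree. Clearing denominators in
  -- the Bézout identity for separability over K yields δ.
  · have hmin := minpoly.isIntegrallyClosed_eq_field_fractions K E hint
    have hsep : (minpoly K (algebraMap B E θ)).Separable :=
      (minpoly.irreducible (Algebra.IsIntegral.isIntegral _)).separable
    obtain ⟨a, b, hab⟩ := hsep
    rw [hmin] at hab
    obtain ⟨c, hc, hca⟩ := IsLocalization.integerNormalization_spec (nonZeroDivisors R) a
    obtain ⟨e, he, heb⟩ := IsLocalization.integerNormalization_spec (nonZeroDivisors R) b
    set a' := IsLocalization.integerNormalization (nonZeroDivisors R) a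
    set b' := IsLocalization.integerNormalization (nonZeroDivisors R) b
    refine ⟨c * e, C e * a', C c * b',
      mul_ne_zero (nonZeroDivisors.ne_zero hc) (nonZeroDivisors.ne_zero he), ?_⟩
    apply Polynomial.map_injective _ hRK
    simp only [Polynomial.map_add, Polynomial.map_mul, Polynomial.map_C, hca, heb,
      ← Polynomial.derivative_map]
    have hsm : ∀ (z : R) (p : K[X]), z • p = C (algebraMap R K z) * p := fun z p => by
      rw [← algebraMap_smul K z p, Polynomial.smul_eq_C_mul]
    rw [hsm, hsm]
    rw [map_mul, map_mul]
    linear_combination (C (algebraMap R K c) * C (algebraMap R K e)) * hab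
  · have hb : algebraMap B E b ∈ Algebra.adjoin K {algebraMap B E θ} := htop ▸ trivial
    obtain ⟨p, hp⟩ := Algebra.adjoin_singleton_eq_range_aeval K (algebraMap B E θ) ▸ hb
    obtain ⟨c, hc, hcp⟩ := IsLocalization.integerNormalization_spec (nonZeroDivisors R) p
    refine ⟨c, IsLocalization.integerNormalization (nonZeroDivisors R) p,
      nonZeroDivisors.ne_zero hc, hBE ?_⟩
    rw [← aeval_algebraMap_apply, ← Polynomial.aeval_map_algebraMap K, hcp, map_mul]
    rw [← algebraMap_smul K c p, map_smul]
    have hp' : aeval (algebraMap B E θ) p = algebraMap B E b := hp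
    rw [hp', Algebra.smul_def, ← IsScalarTower.algebraMap_apply, ← IsScalarTower.algebraMap_apply]

end Primitive

/-! ### Points above a root of a specialized minimal polynomial -/

section LyingOver

variable {d : ℕ} {B : Type*} [CommRing B] [IsDomain B] [Algebra ℂ B]
  [Algebra (MvPolynomial (Fin d) ℂ) B] [IsScalarTower ℂ (MvPolynomial (Fin d) ℂ) B]
  [FaithfulSMul (MvPolynomial (Fin d) ℂ) B] [Algebra.IsIntegral (MvPolynomial (Fin d) ℂ) B]

/-- Every root of a specialized minimal polynomial is the value of the element at a point. -/
theorem exists_algHom_of_root (b : B) {x : Fin d → ℂ} {t : ℂ}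
    (ht : (specialize (minpoly (MvPolynomial (Fin d) ℂ) b) x).eval t = 0) :
    ∃ ψ : B →ₐ[ℂ] ℂ, (∀ r : MvPolynomial (Fin d) ℂ,
      ψ (algebraMap _ B r) = MvPolynomial.eval x r) ∧ ψ b = t := by
  let R := MvPolynomial (Fin d) ℂ
  let φ : R[X] →+* ℂ := Polynomial.eval₂RingHom (MvPolynomial.eval x) t
  let alg : Algebra R[X] B := (aeval b : R[X] →ₐ[R] B).toRingHom.toAlgebra
  have halg : ∀ p : R[X], algebraMap R[X] B p = aeval b p := fun p => rfl
  have htower : IsScalarTower R R[X] B := .of_algebraMap_eq fun r => by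
    rw [halg, Polynomial.algebraMap_apply, Algebra.algebraMap_self_apply, aeval_C]
  have hint : Algebra.IsIntegral R[X] B := Algebra.IsIntegral.tower_top (R := R)
  -- Every relation satisfied by b is a multiple of its minimal polynomial, which evaluation at (x,
  -- t) kills. Hence lying over supplies a prime Q of B above the kernel, and B/Q, integral over ℂ,
  -- equals ℂ.
  have hker : (⊥ : Ideal B).comap (algebraMap R[X] B) ≤ RingHom.ker φ := by
    intro p hp
    have hp0 : aeval b p = 0 := by simpa [halg] using hp
    obtain ⟨q, rfl⟩ := minpoly.isIntegrallyClosed_dvd (Algebra.IsIntegral.isIntegral b) hp0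
    have : φ (minpoly R b) = 0 := by
      rw [← ht, specialize, Polynomial.eval_map]
      rfl
    rw [RingHom.mem_ker, map_mul, this, zero_mul]
  have hprime : (RingHom.ker φ).IsPrime := RingHom.ker_isPrime φ
  obtain ⟨Q, -, hQ, hQφ⟩ := Ideal.exists_ideal_over_prime_of_isIntegral (RingHom.ker φ) ⊥ hker
  have hval : ∀ p : R[X], Ideal.Quotient.mk Q (aeval b p) = algebraMap ℂ (B ⧸ Q) (φ p) := by
    intro p
    have hmem : p - C (MvPolynomial.C (φ p)) ∈ RingHom.ker φ := by
      have hC : φ (C (MvPolynomial.C (φ p))) = φ p :=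
        (Polynomial.eval₂_C _ _).trans (MvPolynomial.eval_C _)
      rw [RingHom.mem_ker, map_sub, hC, sub_self]
    rw [← hQφ, Ideal.mem_comap, halg, map_sub, aeval_C, ← Ideal.Quotient.eq_zero_iff_mem, map_sub,
      sub_eq_zero] at hmem
    rw [hmem]
    have : algebraMap R B (MvPolynomial.C (φ p)) = algebraMap ℂ B (φ p) :=
      (IsScalarTower.algebraMap_apply ℂ R B (φ p)).symm
    rw [this]
    rfl
  have hintQ : Algebra.IsIntegral ℂ (B ⧸ Q) := by
    refine ⟨fun y => ?_⟩
    obtain ⟨c, rfl⟩ := Ideal.Quotient.mk_surjective y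
    obtain ⟨f, hf, hfc⟩ := hint.isIntegral c
    refine ⟨f.map φ, hf.map _, ?_⟩
    have hcomp : (algebraMap ℂ (B ⧸ Q)).comp φ =
        (Ideal.Quotient.mk Q).comp (algebraMap R[X] B) := by
      exact RingHom.ext fun p => (hval p).symm
    rw [Polynomial.eval₂_map, hcomp, ← Polynomial.hom_eval₂, hfc, map_zero]
  let e : ℂ ≃ₐ[ℂ] (B ⧸ Q) := AlgEquiv.ofBijective (Algebra.ofId ℂ (B ⧸ Q))
    IsAlgClosed.algebraMap_bijective_of_isIntegral
  have he : ∀ z : ℂ, e.symm (algebraMap ℂ (B ⧸ Q) z) = z := fun z => by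
    rw [AlgEquiv.symm_apply_eq]
    rfl
  have hψ : ∀ p : R[X], e.symm (Ideal.Quotient.mk Q (aeval b p)) = φ p := fun p => by
    rw [hval, he]
  refine ⟨(e.symm : (B ⧸ Q) →ₐ[ℂ] ℂ).comp (Ideal.Quotient.mkₐ ℂ Q), fun r => ?_, ?_⟩
  · have := hψ (C r)
    simpa [φ] using this
  · have := hψ X
    simpa [φ] using this

end LyingOver

end OMinFlow

end

noncomputable section

namespace OMinFlow

open Filter Topology Polynomial

/-! ### Irreducible algebraic subsets as generic covers of affine space -/

/-- A finite map from an algebraic subset of `ℂⁿ` onto `ℂᵈ`, which over `δ ≠ 0` identifies it with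
the roots of an irreducible polynomial. -/
structure GenericCover {n : ℕ} (X : Set (Fin n → ℂ)) where
  /-- the dimension of the base -/
  d : ℕ
  /-- the projection to the base -/
  proj : (Fin n → ℂ) → (Fin d → ℂ)
  continuous_proj : Continuous proj
  /-- the primitive element -/
  θ : (Fin n → ℂ) → ℂ
  continuous_θ : Continuous θ
  /-- the minimal polynomial of the primitive element -/
  P : (MvPolynomial (Fin d) ℂ)[X]
  /-- the equation of the branch locus -/
  δ : MvPolynomial (Fin d) ℂ
  /-- the numerators of the coordinates in terms of the primitive element -/
  coord : Fin n → (MvPolynomial (Fin d) ℂ)[X]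
  monic : P.Monic
  irreducible : Irreducible P
  δ_ne_zero : δ ≠ 0
  separable : ∀ x, MvPolynomial.eval x δ ≠ 0 → (specialize P x).Separable
  root : ∀ v ∈ X, (specialize P (proj v)).eval (θ v) = 0
  eval_coord : ∀ v ∈ X, ∀ i,
    MvPolynomial.eval (proj v) δ * v i = (specialize (coord i) (proj v)).eval (θ v)
  exists_lift : ∀ x t, (specialize P x).eval t = 0 → ∃ v ∈ X, proj v = x ∧ θ v = t
  exists_minpoly : ∀ f : MvPolynomial (Fin n) ℂ, ∃ μ : (MvPolynomial (Fin d) ℂ)[X], μ.Monic ∧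
    (∀ v ∈ X, (specialize μ (proj v)).eval (MvPolynomial.eval v f) = 0) ∧
    ∀ x t, (specialize μ x).eval t = 0 → ∃ v ∈ X, proj v = x ∧ MvPolynomial.eval v f = t

/-- Points of the zero locus are the ℂ-algebra maps from B to ℂ. Noether normalization of B gives
the projection, a generic primitive element gives θ, and `exists_algHom_of_root` lifts roots to
points. -/
theorem nonempty_genericCover_of_surjective {n : ℕ} {B : Type*} [CommRing B] [IsDomain B]
    [Algebra ℂ B] (m : MvPolynomial (Fin n) ℂ →ₐ[ℂ] B) (hm : Function.Surjective m) :
    Nonempty (GenericCover {v | ∀ p ∈ RingHom.ker m, MvPolynomial.eval v p = 0}) := by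
  set V : Set (Fin n → ℂ) := {v | ∀ p ∈ RingHom.ker m, MvPolynomial.eval v p = 0} with hV
  have : Algebra.FiniteType ℂ B := Algebra.FiniteType.of_surjective m hm
  obtain ⟨d, g, hg, hfin⟩ := exists_finite_inj_algHom_of_fg ℂ B
  let alg : Algebra (MvPolynomial (Fin d) ℂ) B := g.toRingHom.toAlgebra
  have halg : ∀ r, algebraMap (MvPolynomial (Fin d) ℂ) B r = g r := fun r => rfl
  have : Module.Finite (MvPolynomial (Fin d) ℂ) B := hfin
  have : FaithfulSMul (MvPolynomial (Fin d) ℂ) B :=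
    (faithfulSMul_iff_algebraMap_injective _ _).mpr hg
  have : IsScalarTower ℂ (MvPolynomial (Fin d) ℂ) B :=
    .of_algebraMap_eq fun z => (g.commutes z).symm
  obtain ⟨θ, ⟨δ₀, a, b, hδ₀, hab⟩, hgen⟩ :=
    exists_generic_primitive_element (MvPolynomial (Fin d) ℂ) B
  choose r q hr hq using fun i => hgen (m (MvPolynomial.X i))
  choose xh hxh using fun j => hm (g (MvPolynomial.X j))
  obtain ⟨th, hth⟩ := hm θ
  let proj : (Fin n → ℂ) → (Fin d → ℂ) := fun v j => MvPolynomial.eval v (xh j)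
  have hpt : ∀ v ∈ V, ∃ ψ : B →ₐ[ℂ] ℂ, ∀ p, ψ (m p) = MvPolynomial.eval v p := by
    intro v hv
    have hker : ∀ p ∈ RingHom.ker m, MvPolynomial.aeval v p = 0 := fun p hp => by
      simpa [MvPolynomial.aeval_eq_eval] using hv p hp
    refine ⟨(Ideal.Quotient.liftₐ (RingHom.ker m) (MvPolynomial.aeval v) hker).comp
      (Ideal.quotientKerAlgEquivOfSurjective hm).symm, fun p => ?_⟩
    have : (Ideal.quotientKerAlgEquivOfSurjective hm).symm (m p) =
        Ideal.Quotient.mk (RingHom.ker m) p := by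
      rw [AlgEquiv.symm_apply_eq]
      rfl
    simp [this]
  have hpt' : ∀ ψ : B →ₐ[ℂ] ℂ, ∃ v ∈ V, ∀ p, ψ (m p) = MvPolynomial.eval v p := by
    intro ψ
    have key : ∀ p, ψ (m p) =
        MvPolynomial.eval (fun i => ψ (m (MvPolynomial.X i))) p := by
      intro p
      have : ψ.comp (m) = MvPolynomial.aeval
          (fun i => ψ (m (MvPolynomial.X i))) := by
        ext i
        simp
      have h2 := DFunLike.congr_fun this p
      simpa [MvPolynomial.aeval_eq_eval] using h2
    refine ⟨_, fun p hp => ?_, key⟩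
    rw [← key, RingHom.mem_ker.mp hp, map_zero]
  have hbase : ∀ (v : Fin n → ℂ) (ψ : B →ₐ[ℂ] ℂ),
      (∀ p, ψ (m p) = MvPolynomial.eval v p) →
      ∀ s, ψ (algebraMap (MvPolynomial (Fin d) ℂ) B s) = MvPolynomial.eval (proj v) s := by
    intro v ψ hψ s
    have : ψ.comp g = MvPolynomial.aeval (proj v) := by
      ext j
      simp [← hxh, hψ, proj]
    have h2 := DFunLike.congr_fun this s
    simpa [MvPolynomial.aeval_eq_eval, halg] using h2
  have haeval : ∀ (v : Fin n → ℂ) (ψ : B →ₐ[ℂ] ℂ),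
      (∀ p, ψ (m p) = MvPolynomial.eval v p) →
      ∀ (c : B) (p : (MvPolynomial (Fin d) ℂ)[X]),
        ψ (aeval c p) = (specialize p (proj v)).eval (ψ c) := by
    intro v ψ hψ c p
    rw [specialize, Polynomial.eval_map, Polynomial.aeval_def]
    refine (Polynomial.hom_eval₂ p _ (ψ : B →+* ℂ) c).trans ?_
    congr 1
    exact RingHom.ext (hbase v ψ hψ)
  have hmin : ∀ f : MvPolynomial (Fin n) ℂ, ∃ μ : (MvPolynomial (Fin d) ℂ)[X],
      μ = minpoly (MvPolynomial (Fin d) ℂ) (m f) ∧ μ.Monic ∧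
      (∀ v ∈ V, (specialize μ (proj v)).eval (MvPolynomial.eval v f) = 0) ∧
      ∀ x t, (specialize μ x).eval t = 0 → ∃ v ∈ V, proj v = x ∧ MvPolynomial.eval v f = t := by
    intro f
    refine ⟨_, rfl, minpoly.monic (Algebra.IsIntegral.isIntegral _), fun v hv => ?_,
      fun x t hxt => ?_⟩
    · obtain ⟨ψ, hψ⟩ := hpt v hv
      rw [← hψ, ← haeval v ψ hψ, minpoly.aeval, map_zero]
    · obtain ⟨ψ, hψ, hψt⟩ := exists_algHom_of_root (m f) hxt
      obtain ⟨v, hv, hψv⟩ := hpt' ψ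
      refine ⟨v, hv, ?_, by rw [← hψv, hψt]⟩
      ext j
      have h1 := hψ (MvPolynomial.X j)
      rw [hbase v ψ hψv] at h1
      simpa using h1
  obtain ⟨P, hPdef, hPm, hPr, hPl⟩ := hmin th
  rw [hth] at hPdef
  refine ⟨{
    d := d
    proj := proj
    continuous_proj := continuous_pi fun j => MvPolynomial.continuous_eval _
    θ := fun v => MvPolynomial.eval v th
    continuous_θ := MvPolynomial.continuous_eval _
    P := P
    -- The factor δ₀ ensures separability; the r i are the denominators of the coordinates as
    -- polynomials in θ.
    δ := δ₀ * ∏ i, r i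
    coord := fun i => C (δ₀ * ∏ j ∈ Finset.univ.erase i, r j) * q i
    monic := hPm
    irreducible := hPdef ▸ minpoly.irreducible (Algebra.IsIntegral.isIntegral θ)
    δ_ne_zero := mul_ne_zero hδ₀ (Finset.prod_ne_zero_iff.mpr fun i _ => hr i)
    separable := fun x hx => ?_
    root := hPr
    eval_coord := fun v hv i => ?_
    exists_lift := hPl
    exists_minpoly := fun f => ?_ }⟩
  · have hx0 : MvPolynomial.eval x δ₀ ≠ 0 := by
      rw [map_mul] at hx
      exact left_ne_zero_of_mul hx
    rw [← hPdef] at hab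
    have h := congrArg (Polynomial.map (MvPolynomial.eval x)) hab
    simp only [Polynomial.map_add, Polynomial.map_mul, Polynomial.map_C,
      ← Polynomial.derivative_map] at h
    refine ⟨C (MvPolynomial.eval x δ₀)⁻¹ * a.map (MvPolynomial.eval x),
      C (MvPolynomial.eval x δ₀)⁻¹ * b.map (MvPolynomial.eval x), ?_⟩
    have hC : (C (MvPolynomial.eval x δ₀)⁻¹ * C (MvPolynomial.eval x δ₀) : ℂ[X]) = 1 := by
      rw [← C_mul, inv_mul_cancel₀ hx0, C_1]
    linear_combination C (MvPolynomial.eval x δ₀)⁻¹ * h + hC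
  · obtain ⟨ψ, hψ⟩ := hpt v hv
    have h1 := congrArg ψ (hq i)
    rw [map_mul, hbase v ψ hψ, haeval v ψ hψ, hψ, ← hth, hψ, MvPolynomial.eval_X] at h1
    rw [specialize, Polynomial.map_mul, Polynomial.map_C, Polynomial.eval_mul, Polynomial.eval_C,
      ← specialize, ← h1, ← Finset.mul_prod_erase Finset.univ r (Finset.mem_univ i)]
    simp only [map_mul]
    ring
  · obtain ⟨μ, -, h⟩ := hmin f
    exact ⟨μ, h⟩

theorem nonempty_genericCover {n : ℕ} (I : Ideal (MvPolynomial (Fin n) ℂ)) [I.IsPrime] :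
    Nonempty (GenericCover {v | ∀ p ∈ I, MvPolynomial.eval v p = 0}) := by
  have h := nonempty_genericCover_of_surjective (Ideal.Quotient.mkₐ ℂ I)
    (Ideal.Quotient.mkₐ_surjective ℂ I)
  have hker : RingHom.ker (Ideal.Quotient.mkₐ ℂ I) = I := Ideal.Quotient.mkₐ_ker ℂ I
  rwa [hker] at h

namespace GenericCover

variable {n : ℕ} {X : Set (Fin n → ℂ)} (Y : GenericCover X)

/-- Each coordinate is a root of a monic polynomial over the base. The bound expresses properness of
the projection on X. -/
theorem exists_norm_le : ∃ (K : ℝ) (N : ℕ), 0 ≤ K ∧ ∀ v ∈ X, ‖v‖ ≤ K * (1 + ‖Y.proj v‖) ^ N := by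
  choose μ hμ hr _ using fun i : Fin n => Y.exists_minpoly (MvPolynomial.X i)
  choose K N hK h using fun i => exists_norm_root_le (hμ i)
  refine ⟨∑ i, K i, ∑ i, N i, Finset.sum_nonneg fun i _ => hK i, fun v hv => ?_⟩
  have h1 : (1 : ℝ) ≤ 1 + ‖Y.proj v‖ := by linarith [norm_nonneg (Y.proj v)]
  have hnn : 0 ≤ ∑ i, K i := Finset.sum_nonneg fun i _ => hK i
  refine (pi_norm_le_iff_of_nonneg (by positivity)).mpr fun i => ?_
  have h2 := h i _ _ (hr i v hv)
  rw [MvPolynomial.eval_X] at h2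
  refine h2.trans ?_
  gcongr
  · exact Finset.single_le_sum (f := K) (fun i _ => hK i) (Finset.mem_univ i)
  · exact Finset.single_le_sum (f := N) (fun i _ => Nat.zero_le _) (Finset.mem_univ i)

theorem finite_fiber (x : Fin Y.d → ℂ) : {v | v ∈ X ∧ Y.proj v = x}.Finite := by
  choose μ hμ hr _ using fun i : Fin n => Y.exists_minpoly (MvPolynomial.X i)
  refine (Set.Finite.pi' (t := fun i => {t | (specialize (μ i) x).IsRoot t}) fun i =>
    Polynomial.finite_setOfPred_isRoot ((hμ i).map _).ne_zero).subset ?_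
  rintro v ⟨hv, rfl⟩ i
  have := hr i v hv
  rwa [MvPolynomial.eval_X] at this

end GenericCover

/-- A polynomial that vanishes at a given point and at no point of a given finite set. -/
theorem exists_eval_eq_zero_and_ne_zero {n : ℕ} (p : Fin n → ℂ) {S : Set (Fin n → ℂ)}
    (hS : S.Finite) : ∃ f : MvPolynomial (Fin n) ℂ, MvPolynomial.eval p f = 0 ∧
      ∀ v ∈ S, v ≠ p → MvPolynomial.eval v f ≠ 0 := by
  classical
  have hsep : ∀ v : Fin n → ℂ, ∃ f : MvPolynomial (Fin n) ℂ, v ≠ p →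
      MvPolynomial.eval v f = 0 ∧ MvPolynomial.eval p f ≠ 0 := by
    intro v
    by_cases hv : v = p
    · exact ⟨0, fun h => absurd hv h⟩
    · obtain ⟨i, hi⟩ := Function.ne_iff.mp hv
      refine ⟨MvPolynomial.X i - MvPolynomial.C (v i), fun _ => ⟨by simp, ?_⟩⟩
      simpa [sub_eq_zero] using Ne.symm hi
  choose f hf using hsep
  -- This product vanishes on S away from p but not at p; subtracting its value at p exchanges the
  -- two roles.
  set N := ∏ v ∈ hS.toFinset.erase p, f v with hN
  have hNp : MvPolynomial.eval p N ≠ 0 := by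
    rw [hN, map_prod]
    exact Finset.prod_ne_zero_iff.mpr fun v hv => (hf v (Finset.ne_of_mem_erase hv)).2
  refine ⟨N - MvPolynomial.C (MvPolynomial.eval p N), by simp, fun v hv hvp => ?_⟩
  have hNv : MvPolynomial.eval v N = 0 := by
    rw [hN, map_prod]
    exact Finset.prod_eq_zero (Finset.mem_erase.mpr ⟨hvp, hS.mem_toFinset.mpr hv⟩) (hf v hvp).1
  simpa [hNv] using hNp

/-- A monic polynomial with small constant coefficient has a small root. -/
theorem exists_root_norm_lt {p : ℂ[X]} (hp : p.Monic) {η : ℝ}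
    (h0 : ‖p.eval 0‖ < η ^ p.natDegree) (hη : 0 < η) : ∃ t, p.eval t = 0 ∧ ‖t‖ < η := by
  by_contra! h
  have hsplit : p = (p.roots.map (X - C ·)).prod :=
    (Polynomial.prod_multiset_X_sub_C_of_monic_of_roots_card_eq hp
      IsAlgClosed.card_roots_eq_natDegree).symm
  have hle : ∀ s : Multiset ℂ, (∀ t ∈ s, η ≤ ‖t‖) →
      η ^ Multiset.card s ≤ ‖((s.map (X - C ·)).prod).eval 0‖ := by
    intro s
    induction s using Multiset.induction_on with
    | empty => simp
    | cons a s ih =>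
      intro hs
      have h1 := ih fun t ht => hs t (Multiset.mem_cons_of_mem ht)
      have h2 := hs a (Multiset.mem_cons_self a s)
      rw [Multiset.map_cons, Multiset.prod_cons, Polynomial.eval_mul, norm_mul, Multiset.card_cons,
        pow_succ']
      have h3 : ‖(X - C a : ℂ[X]).eval 0‖ = ‖a‖ := by simp
      rw [h3]
      gcongr
  have := hle p.roots fun t ht => h t ((Polynomial.mem_roots hp.ne_zero).mp ht)
  rw [← hsplit, IsAlgClosed.card_roots_eq_natDegree] at this
  linarith

/-- On the line joining x to a point where δ is nonzero, δ has only finitely many zeros. -/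
theorem dense_eval_ne_zero {d : ℕ} {δ : MvPolynomial (Fin d) ℂ} (hδ : δ ≠ 0) :
    Dense {x | MvPolynomial.eval x δ ≠ 0} := by
  intro x
  obtain ⟨y, hy⟩ := MvPolynomial.exists_eval_ne_zero hδ
  have hfin := finite_setOf_eval_line_eq_zero (y := x - y) hy
  have hdense : Dense {t : ℂ | MvPolynomial.eval (y + t • (x - y)) δ = 0}ᶜ :=
    hfin.countable.dense_compl ℂ
  have hc : Continuous fun t : ℂ => y + t • (x - y) := by fun_prop
  have := map_mem_closure hc (hdense 1) (t := {x | MvPolynomial.eval x δ ≠ 0}) fun t ht => ht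
  simpa using this

namespace GenericCover

variable {n : ℕ} {X : Set (Fin n → ℂ)} (Y : GenericCover X)

/-- The part of the cover over `δ ≠ 0` is dense. -/
theorem exists_mem_ball (hX : IsClosed X) {p : Fin n → ℂ} (hp : p ∈ X) {ε : ℝ} (hε : 0 < ε) :
    ∃ v ∈ X, ‖v - p‖ < ε ∧ MvPolynomial.eval (Y.proj v) Y.δ ≠ 0 := by
  -- Within its fibre, p is the only zero of f. For nearby x off δ = 0 the monic equation of f has a
  -- small root, hence a point of X over x with f small; compactness forces it close to p.
  obtain ⟨f, hfp, hf⟩ := exists_eval_eq_zero_and_ne_zero p (Y.finite_fiber (Y.proj p))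
  obtain ⟨μ, hμ, hμr, hμl⟩ := Y.exists_minpoly f
  obtain ⟨K, N, hK, hb⟩ := Y.exists_norm_le
  set x₀ := Y.proj p with hx₀
  have hcont : Continuous fun v => (Y.proj v, MvPolynomial.eval v f) :=
    Y.continuous_proj.prodMk (MvPolynomial.continuous_eval f)
  -- The radius bounds all points of X lying over the unit ball around x₀.
  set S : Set (Fin n → ℂ) := X ∩ Metric.closedBall 0 (K * (1 + (‖x₀‖ + 1)) ^ N) ∩
    {v | ε ≤ ‖v - p‖} with hS
  have hScpt : IsCompact S := by
    refine ((isCompact_closedBall (0 : Fin n → ℂ) _).inter_left hX).inter_right ?_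
    exact isClosed_le continuous_const (by fun_prop)
  have hSimg : (x₀, (0 : ℂ)) ∉ (fun v => (Y.proj v, MvPolynomial.eval v f)) '' S := by
    rintro ⟨v, ⟨⟨hvX, -⟩, hvp⟩, hv⟩
    simp only [Prod.mk.injEq] at hv
    refine hf v ⟨hvX, hv.1⟩ ?_ hv.2
    rintro rfl
    simp at hvp
    linarith
  obtain ⟨η, hη, hball⟩ := Metric.isOpen_iff.mp (hScpt.image hcont).isClosed.isOpen_compl _ hSimg
  have hc : ContinuousAt (fun x => ‖(specialize μ x).eval 0‖) x₀ := by
    have : AnalyticAt ℂ (fun x => (specialize μ x).eval 0) x₀ := by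
      refine (analyticAt_specialize μ (x₀, 0)).comp_of_eq (g := fun q : (Fin Y.d → ℂ) × ℂ =>
        (specialize μ q.1).eval q.2) (f := fun x => (x, (0 : ℂ)))
        (analyticAt_id.prod analyticAt_const) rfl
    exact this.continuousAt.norm
  have hc0 : ‖(specialize μ x₀).eval 0‖ < η ^ μ.natDegree := by
    have := hμr p hp
    rw [hfp] at this
    rw [this, norm_zero]
    positivity
  have hev : ∀ᶠ x in 𝓝 x₀, ‖(specialize μ x).eval 0‖ < η ^ μ.natDegree ∧
      x ∈ Metric.ball x₀ (min η 1) :=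
    (hc.eventually_lt_const hc0).and (Metric.ball_mem_nhds _ (by positivity))
  obtain ⟨x, hx, hxδ⟩ := mem_closure_iff_nhds.mp (dense_eval_ne_zero Y.δ_ne_zero x₀) _ hev
  have hdegx : (specialize μ x).natDegree = μ.natDegree := hμ.natDegree_map _
  obtain ⟨t, ht, htη⟩ := exists_root_norm_lt (hμ.map (MvPolynomial.eval x))
    (by rw [hdegx]; exact hx.1) hη
  obtain ⟨v, hv, hvx, hvt⟩ := hμl x t ht
  refine ⟨v, hv, ?_, by rw [hvx]; exact hxδ⟩
  by_contra hvp
  have hxx : dist x x₀ < min η 1 := hx.2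
  have hvS : v ∈ S := by
    refine ⟨⟨hv, ?_⟩, not_lt.mp hvp⟩
    rw [mem_closedBall_zero_iff]
    refine (hb v hv).trans ?_
    have hxn : ‖x‖ ≤ ‖x₀‖ + 1 := by
      have h1 : ‖x - x₀‖ < 1 := by
        rw [← dist_eq_norm]
        exact hxx.trans_le (min_le_right _ _)
      linarith [norm_le_norm_add_norm_sub x₀ x, norm_sub_rev x₀ x]
    rw [hvx]
    gcongr
  refine hball (a := (x, t)) ?_ ⟨v, hvS, Prod.ext hvx hvt⟩
  rw [Metric.mem_ball, Prod.dist_eq, max_lt_iff]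
  exact ⟨hxx.trans_le (min_le_left _ _), by simpa using htη⟩

/-- The point of the cover with a given root of the defining polynomial. -/
def point (q : (Fin Y.d → ℂ) × ℂ) : Fin n → ℂ :=
  fun i => (specialize (Y.coord i) q.1).eval q.2 / MvPolynomial.eval q.1 Y.δ

theorem point_eq {v : Fin n → ℂ} (hv : v ∈ X) (hδ : MvPolynomial.eval (Y.proj v) Y.δ ≠ 0) :
    Y.point (Y.proj v, Y.θ v) = v := by
  ext i
  rw [point, ← Y.eval_coord v hv i, mul_div_cancel_left₀ _ hδ]

theorem point_spec {q : (Fin Y.d → ℂ) × ℂ} (hq : (specialize Y.P q.1).eval q.2 = 0)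
    (hδ : MvPolynomial.eval q.1 Y.δ ≠ 0) :
    Y.point q ∈ X ∧ Y.proj (Y.point q) = q.1 ∧ Y.θ (Y.point q) = q.2 := by
  obtain ⟨v, hv, h1, h2⟩ := Y.exists_lift _ _ hq
  have : Y.point q = v := by
    rw [← Y.point_eq hv (by rwa [h1]), h1, h2]
  rw [this]
  exact ⟨hv, h1, h2⟩

theorem analyticAt_point {q : (Fin Y.d → ℂ) × ℂ} (hδ : MvPolynomial.eval q.1 Y.δ ≠ 0) :
    AnalyticAt ℂ Y.point q := by
  rw [analyticAt_pi_iff]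
  intro i
  exact (analyticAt_specialize (Y.coord i) q).div
    ((analyticAt_mvPolynomial_eval Y.δ q.1).comp analyticAt_fst) hδ

/-- A branch τ gives a local analytic parametrization of X, so being locally inside A can be tested
on parameters, where the identity principle propagates it over a ball. -/
theorem isMonodromyInvariant {A : Set (Fin n → ℂ)} (hA : IsAnalyticSet A) :
    IsMonodromyInvariant Y.P Y.δ {q | ∀ᶠ w in 𝓝[X] (Y.point q), w ∈ A} := by
  intro x₀ hx₀ τ hτ hroot
  have hδev : ∀ᶠ x in 𝓝 x₀, MvPolynomial.eval x Y.δ ≠ 0 :=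
    (analyticAt_mvPolynomial_eval Y.δ x₀).continuousAt.eventually_ne hx₀
  obtain ⟨ρ, hρ, hball⟩ := Metric.eventually_nhds_iff_ball.mp
    ((hδev.and hτ.eventually_analyticAt).and hroot)
  let f : (Fin Y.d → ℂ) → (Fin n → ℂ) := fun x => Y.point (x, τ x)
  have hf : AnalyticOnNhd ℂ f (Metric.ball x₀ ρ) := fun x hx =>
    (Y.analyticAt_point (q := (x, τ x)) (hball x hx).1.1).comp_of_eq (f := fun x => (x, τ x))
      (analyticAt_id.prod (hball x hx).1.2) rfl
  have hfR : AnalyticOnNhd ℝ f (Metric.ball x₀ ρ) := fun x hx => (hf x hx).restrictScalars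
  have hconn : IsPreconnected (Metric.ball x₀ ρ) := (convex_ball x₀ ρ).isPreconnected
  have hlocal : ∀ x ∈ Metric.ball x₀ ρ,
      (∀ᶠ w in 𝓝[X] (f x), w ∈ A) ↔ ∀ᶠ y in 𝓝 x, f y ∈ A := by
    intro x hx
    have hxball : ∀ᶠ y in 𝓝 x, y ∈ Metric.ball x₀ ρ := Metric.isOpen_ball.mem_nhds hx
    have hxroot : ∀ᶠ y in 𝓝 x, (specialize Y.P y).eval (τ y) = 0 := by
      filter_upwards [hxball] with y hy using (hball y hy).2
    have hspec := Y.point_spec (q := (x, τ x)) (hball x hx).2 (hball x hx).1.1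
    constructor
    · intro h
      have htend : Tendsto f (𝓝 x) (𝓝[X] (f x)) := by
        refine tendsto_nhdsWithin_iff.mpr ⟨(hf x hx).continuousAt, ?_⟩
        filter_upwards [hxball] with y hy
        exact (Y.point_spec (q := (y, τ y)) (hball y hy).2 (hball y hy).1.1).1
      exact htend.eventually h
    · intro h
      have huniq := eventually_eq_branch Y.P (Y.separable x (hball x hx).1.1)
        (hball x hx).1.2.continuousAt hxroot
      have htend : Tendsto (fun w => (Y.proj w, Y.θ w)) (𝓝[X] (f x)) (𝓝 (x, τ x)) := by
        have hc : ContinuousAt (fun w => (Y.proj w, Y.θ w)) (f x) :=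
          (Y.continuous_proj.prodMk Y.continuous_θ).continuousAt
        have hval : (Y.proj (f x), Y.θ (f x)) = (x, τ x) := Prod.ext hspec.2.1 hspec.2.2
        rw [← hval]
        exact hc.tendsto.mono_left nhdsWithin_le_nhds
      have hfst : Tendsto (fun w => Y.proj w) (𝓝[X] (f x)) (𝓝 x) :=
        (continuous_fst.tendsto (x, τ x)).comp htend
      filter_upwards [htend.eventually huniq, hfst.eventually h, hfst.eventually hxball,
        self_mem_nhdsWithin] with w hw hwA hwball hwX
      have hθ : Y.θ w = τ (Y.proj w) := hw (Y.root w hwX)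
      have : f (Y.proj w) = w := by
        change Y.point (Y.proj w, τ (Y.proj w)) = w
        rw [← hθ, Y.point_eq hwX (hball _ hwball).1.1]
      rwa [this] at hwA
  have hx₀b : x₀ ∈ Metric.ball x₀ ρ := Metric.mem_ball_self hρ
  filter_upwards [Metric.ball_mem_nhds x₀ hρ] with x hx
  refine (hlocal x hx).trans (Iff.trans ⟨fun h => ?_, fun h => ?_⟩ (hlocal x₀ hx₀b).symm)
  · exact hA.mem_of_eventually_mem hfR hconn hx h hx₀b
  · exact hA.mem_of_eventually_mem hfR hconn hx₀b h hx

/-- The identity principle for algebraic subsets with a generic cover. -/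
theorem subset_of_inter_subset (Y : GenericCover X) (hX : IsClosed X) {A : Set (Fin n → ℂ)}
    (hA : IsAnalyticSet A)
    (hAc : IsClosed A) {O : Set (Fin n → ℂ)} (hO : IsOpen O) (hne : (X ∩ O).Nonempty)
    (hsub : X ∩ O ⊆ A) : X ⊆ A := by
  obtain ⟨p, hpX, hpO⟩ := hne
  obtain ⟨ε, hε, hball⟩ := Metric.isOpen_iff.mp hO p hpO
  obtain ⟨v, hvX, hvp, hvδ⟩ := Y.exists_mem_ball hX hpX hε
  have hvO : v ∈ O := hball (by rwa [Metric.mem_ball, dist_eq_norm])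
  have hvA : ∀ᶠ w in 𝓝[X] (Y.point (Y.proj v, Y.θ v)), w ∈ A := by
    rw [Y.point_eq hvX hvδ]
    filter_upwards [self_mem_nhdsWithin, nhdsWithin_le_nhds (hO.mem_nhds hvO)] with w hwX hwO
    exact hsub ⟨hwX, hwO⟩
  have hall : ∀ x t, MvPolynomial.eval x Y.δ ≠ 0 → (specialize Y.P x).eval t = 0 →
      ∀ᶠ w in 𝓝[X] (Y.point (x, t)), w ∈ A :=
    ((Y.isMonodromyInvariant hA).all_or_none Y.monic Y.irreducible Y.δ_ne_zero
      Y.separable).resolve_right fun h => h _ _ hvδ (Y.root v hvX) hvA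
  intro w hw
  refine hAc.closure_subset (Metric.mem_closure_iff.mpr fun ε hε => ?_)
  obtain ⟨u, huX, hup, huδ⟩ := Y.exists_mem_ball hX hw hε
  refine ⟨u, ?_, by rwa [dist_comm, dist_eq_norm]⟩
  have := hall _ _ huδ (Y.root u huX)
  rw [Y.point_eq huX huδ] at this
  exact this.self_of_nhdsWithin huX

end GenericCover

end OMinFlow

end

noncomputable section

namespace OMinFlow

open Filter Topology

/-! ### The identity principle for irreducible subvarieties -/

section Irreducible

variable {V W : Type*} [NormedAddCommGroup V] [NormedSpace ℂ V]
  [NormedAddCommGroup W] [NormedSpace ℂ W]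

theorem IsAnalyticSet.isClosed {A : Set V} (hA : IsAnalyticSet A) : IsClosed A := by
  rw [← isOpen_compl_iff, isOpen_iff_mem_nhds]
  intro x hx
  obtain ⟨N, hN, hxN, H, hH, hHN⟩ := hA x
  have hx' : ¬ ∀ h ∈ H, h x = 0 := fun h => hx ((hHN x hxN).mpr h)
  push Not at hx'
  obtain ⟨h, hh, hhx⟩ := hx'
  filter_upwards [hN.mem_nhds hxN, (hH h hh x hxN).continuousAt.eventually_ne hhx] with y hyN hy hyA
  exact hy ((hHN y hyN).mp hyA h hh)

theorem IsAnalyticSet.preimage_clm {A : Set V} (hA : IsAnalyticSet A) (e : W →L[ℂ] V) :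
    IsAnalyticSet (e ⁻¹' A) := by
  intro x
  obtain ⟨N, hN, hx, H, hH, hHN⟩ := hA (e x)
  refine ⟨e ⁻¹' N, hN.preimage e.continuous, hx, (fun h => h ∘ e) '' H, ?_, ?_⟩
  · rintro _ ⟨h, hh, rfl⟩
    exact fun y hy => (hH h hh (e y) hy).comp (e.analyticAt y)
  · intro y hy
    simpa using hHN (e y) hy

/-- In coordinates, irreducibility makes the full vanishing ideal of X prime, so X has a generic
cover. The ideal spanned by the given equations need not be prime. -/
theorem IsIrreducibleSubvariety.subset_of_inter_subset [FiniteDimensional ℂ V] {X : Set V}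
    (hX : IsIrreducibleSubvariety X) {A : Set V} (hA : IsAnalyticSet A) {O : Set V}
    (hO : IsOpen O) (hne : (X ∩ O).Nonempty) (hsub : X ∩ O ⊆ A) : X ⊆ A := by
  obtain ⟨⟨b, P, hXP⟩, ⟨x₀, hx₀⟩, hirr⟩ := hX
  let e : V ≃L[ℂ] (Fin (Module.finrank ℂ V) → ℂ) := b.equivFun.toContinuousLinearEquiv
  have he : ∀ v, e v = b.equivFun v := fun v => rfl
  let I : Ideal (MvPolynomial (Fin (Module.finrank ℂ V)) ℂ) :=
    MvPolynomial.vanishingIdeal ℂ (e '' X)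
  have hI : ∀ p, p ∈ I ↔ ∀ v ∈ X, MvPolynomial.eval (e v) p = 0 := by
    intro p
    simp [I, MvPolynomial.mem_vanishingIdeal_iff, MvPolynomial.aeval_eq_eval]
  have hprime : I.IsPrime := by
    refine ⟨fun h => ?_, fun {p q} hpq => ?_⟩
    · have h1 : (1 : MvPolynomial (Fin (Module.finrank ℂ V)) ℂ) ∈ I := h ▸ trivial
      simpa using (hI 1).mp h1 x₀ hx₀
    · have hcov : X ⊆ {v | ∀ r ∈ ({p} : Set _), MvPolynomial.eval (b.equivFun v) r = 0} ∪
          {v | ∀ r ∈ ({q} : Set _), MvPolynomial.eval (b.equivFun v) r = 0} := by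
        intro v hv
        have := (hI _).mp hpq v hv
        rw [map_mul, mul_eq_zero] at this
        simpa [he] using this
      rcases hirr _ _ ⟨b, {p}, rfl⟩ ⟨b, {q}, rfl⟩ hcov with h | h
      · exact Or.inl ((hI p).mpr fun v hv => h hv p rfl)
      · exact Or.inr ((hI q).mpr fun v hv => h hv q rfl)
  have himage : e '' X = {w | ∀ p ∈ I, MvPolynomial.eval w p = 0} := by
    ext w
    constructor
    · rintro ⟨v, hv, rfl⟩ p hp
      exact (hI p).mp hp v hv
    · intro hw
      refine ⟨e.symm w, ?_, e.apply_symm_apply w⟩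
      rw [hXP]
      intro p hp
      rw [← he, e.apply_symm_apply]
      refine hw p ((hI p).mpr fun v hv => ?_)
      rw [hXP] at hv
      exact hv p hp
  have hclosed : IsClosed (e '' X) := by
    rw [himage]
    have : {w : Fin (Module.finrank ℂ V) → ℂ | ∀ p ∈ I, MvPolynomial.eval w p = 0} =
        ⋂ p ∈ I, {w | MvPolynomial.eval w p = 0} := by
      ext w
      simp
    rw [this]
    exact isClosed_biInter fun p _ => isClosed_eq (MvPolynomial.continuous_eval p) continuous_const
  obtain ⟨Y⟩ := nonempty_genericCover I
  rw [← himage] at Y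
  have hA' : IsAnalyticSet (e.symm ⁻¹' A) := hA.preimage_clm e.symm.toContinuousLinearMap
  have key := Y.subset_of_inter_subset hclosed hA' hA'.isClosed
    (hO.preimage e.symm.continuous) ?_ ?_
  · intro v hv
    simpa using key ⟨v, hv, rfl⟩
  · obtain ⟨v, hv, hvO⟩ := hne
    exact ⟨e v, ⟨v, hv, rfl⟩, by simpa using hvO⟩
  · rintro _ ⟨⟨v, hv, rfl⟩, hvO⟩
    simpa using hsub ⟨hv, by simpa using hvO⟩

end Irreducible

end OMinFlow

end

/-! ### The stabilizer of the Zariski closure -/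

open CategoryTheory AlgebraicGeometry OMinFlow in
open scoped MonObj Pointwise in
/-- `G` is a connected commutative algebraic group over `ℂ` (a group scheme of finite type),
`π : V → G(ℂ)` a complex analytic homomorphism with discrete kernel `Λ`, and `F` a definable large
domain for `π`. -/
theorem mainTheorem5
    (L : FirstOrder.Language) [L.Structure ℝ] (hL : IsOMinimalExpansion L)
    {V : Type*} [NormedAddCommGroup V] [NormedSpace ℂ V] [FiniteDimensional ℂ V]
    (G : Over (Spec (.of ℂ))) [GrpObj G] [IsCommMonObj G]
    [LocallyOfFiniteType G.hom] [QuasiCompact G.hom] [ConnectedSpace G.left]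
    (π : Multiplicative V →* CPoints G)
    (hπ : IsComplexAnalytic (fun v : V => π (Multiplicative.ofAdd v)))
    (Λ : AddSubgroup V) (hΛ : Λ = π.ker.toAddSubgroup')
    (hdisc : DiscreteTopology Λ)
    (F : Set V)
    (hF : IsDefinableLargeDomain L (fun v : V => π (Multiplicative.ofAdd v)) Λ F)
    (X : Set V)
    (hX : (DefinableIn L X ∧ IsConnected X ∧ IsAnalyticSubmanifold X) ∨
      IsIrreducibleSubvariety X)
    (hcov : ¬ ∃ T : Set V, T.Finite ∧ T ⊆ Λ ∧ X ⊆ ⋃ l ∈ T, l +ᵥ F)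
    (Z : Set (CPoints G))
    (hZ : Z = zariskiClosure ((fun v : V => π (Multiplicative.ofAdd v)) '' X)) :
    (MulAction.stabilizer (CPoints G) Z : Set (CPoints G)).Infinite := by
  have : CompleteSpace V := FiniteDimensional.complete ℂ V
  have : FiniteDimensional ℝ V := FiniteDimensional.complexToReal V
  set ϖ : V → CPoints G := fun v => π (Multiplicative.ofAdd v) with hϖ
  have hadd : ∀ v w, ϖ (v + w) = ϖ v * ϖ w := fun v w => π.map_mul _ _
  have hmemΛ : ∀ v, v ∈ Λ ↔ ϖ v = 1 := fun v => by
    rw [hΛ]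
    rfl
  have hZcl : @IsClosed _ (zariskiTopology G) Z := by
    let := zariskiTopology G
    rw [hZ]
    exact isClosed_closure
  have hXZ : ∀ x ∈ X, ϖ x ∈ Z := by
    let := zariskiTopology G
    intro x hx
    rw [hZ]
    exact subset_closure ⟨x, hx, rfl⟩
  have hident : ∀ A : Set V, IsAnalyticSet A → ∀ O : Set V, IsOpen O → (X ∩ O).Nonempty →
      X ∩ O ⊆ A → X ⊆ A := by
    intro A hA O hO hne hsub
    rcases hX with ⟨-, hconn, hman⟩ | hirr
    · exact hman.subset_of_inter_subset hconn.isPreconnected hA hO hne hsub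
    · exact hirr.subset_of_inter_subset hA hO hne hsub
  have hXdef : DefinableIn L X := by
    rcases hX with ⟨h, -⟩ | hirr
    · exact h
    · exact hirr.1.definableIn hL
  -- The first difference says that v + X meets F; the removed set consists of the v for which some
  -- point of (v + X) ∩ F maps outside Z.
  set S : Set V := (F - X) \ ((F \ ϖ ⁻¹' Z) - X) with hS
  have hSdef : DefinableIn L S :=
    hL.definableIn_diff (hL.definableIn_sub hF.definable.1 hXdef)
      (hL.definableIn_sub (hF.definable.definableIn_diff hL hZcl) hXdef)
  have hSstab : ∀ v ∈ S, ϖ v ∈ MulAction.stabilizer (CPoints G) Z := by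
    rintro v ⟨⟨f, hf, x, hx, rfl⟩, hv⟩
    have hana := (hπ.isAnalyticSet_preimage hZcl).preimage_add_left (f - x)
    have hsub := hident _ hana ((fun y => (f - x) + y) ⁻¹' F)
      (hF.isOpen.preimage (continuous_const_add _))
      ⟨x, hx, show f - x + x ∈ F by simpa using hf⟩ ?_
    · rw [hZ]
      refine mem_stabilizer_zariskiClosure ?_
      rintro _ ⟨y, hy, rfl⟩
      rw [← hZ, ← hadd]
      exact hsub hy
    · rintro y ⟨hy, hyF⟩
      by_contra hyZ
      exact hv ⟨(f - x) + y, ⟨hyF, hyZ⟩, y, hy, by simp⟩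
  intro hfin
  have hΛc : (Λ : Set V).Countable := by
    have : SecondCountableTopology V := inferInstance
    exact Set.countable_coe_iff.mp (TopologicalSpace.separableSpace_iff_countable.mp inferInstance)
  have hSc : S.Countable := by
    have hfib : ∀ g : CPoints G, (ϖ ⁻¹' {g}).Countable := by
      intro g
      rcases (ϖ ⁻¹' {g}).eq_empty_or_nonempty with h | ⟨v, hv⟩
      · rw [h]
        exact Set.countable_empty
      · have hsub : ϖ ⁻¹' {g} ⊆ (fun l => v + l) '' (Λ : Set V) := by
          intro w hw
          refine ⟨-v + w, ?_, add_neg_cancel_left v w⟩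
          have h1 : ϖ (-v) * ϖ v = 1 := by
            rw [← hadd, neg_add_cancel]
            exact π.map_one
          have hvw : ϖ w = ϖ v := (show ϖ w = g from hw).trans (show ϖ v = g from hv).symm
          rw [SetLike.mem_coe, hmemΛ, hadd, hvw, h1]
        exact (hΛc.image _).mono hsub
    refine (hfin.countable.biUnion fun g _ => hfib g).mono fun v hv => ?_
    exact Set.mem_biUnion (hSstab v hv) rfl
  have hSfin : S.Finite := hL.finite_of_definableIn_of_countable hSdef hSc
  -- If l + F meets X, then -l + X meets F and has the same image in Z as X, so -l lies in S.
  refine hcov ⟨-(S ∩ Λ), (hSfin.inter_of_left _).neg, ?_, ?_⟩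
  · rintro l ⟨-, hl⟩
    simpa using hl
  · intro x hx
    have hxu : x ∈ F + (Λ : Set V) := hF.add_eq ▸ Set.mem_univ x
    obtain ⟨f, hf, l, hl, rfl⟩ := hxu
    have hmem : f + l ∈ l +ᵥ F := ⟨f, hf, add_comm l f⟩
    refine Set.mem_biUnion (x := l) ?_ hmem
    refine ⟨⟨⟨f, hf, f + l, hx, by simp⟩, ?_⟩, by simpa using hl⟩
    rintro ⟨w, ⟨hwF, hwZ⟩, y, hy, hwy⟩
    apply hwZ
    have hw : w = -l + y := by
      rw [← hwy]
      simp
    have hl' : ϖ (-l) = 1 := (hmemΛ _).mp (neg_mem hl)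
    change ϖ w ∈ Z
    rw [hw, hadd, hl', one_mul]
    exact hXZ y hy
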